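/- For $\nu\in\mathbb R$ let $F_\nu:\mathbb R^3\to\mathbb R^3$ be the right-hand side of $$x' = x(\nu - x^2) + x^3(y+z) + x(y^2+z^2) + yz,\qquad y' = y + x^2(y+z) + x^4 + yz,\qquad z' = -z + x^2(y+z) + x^4 + yz.$$ A \emph{full solution} is a solution of $u'=F_\nu(u)$ defined for all $t\in\mathbb R$. The \emph{maximal invariant set} in $S\subset\mathbb R^3$ is the largest $I\subset S$ such that a point of $S$ belongs to $I$ if and only if there is a full solution through it and every full solution through it stays in $I$. A fixed point $p$ is \emph{hyperbolic} if $DF_\nu(p)$ has no eigenvalue on the imaginary axis and there are a symmetric matrix $Q$, a neighbourhood $U$ of $p$ and constants $\lambda,\delta_0,C,l>0$ such that: (i) $2\langle (Q+\delta\,\mathrm{Id})(z_1-z_2),F_\nu(z_1)-F_\nu(z_2)\rangle\ge\lambda\|z_1-z_2\|^2$ for all $z_1,z_2\in U$ and $|\delta|\le\delta_0$; (ii) every solution $u$ on $[0,\infty)$ that stays in $U$ satisfies $\langle Q(u(0)-p),u(0)-p\rangle\le 0$ and $\|u(t)-p\|\le Ce^{-lt}\|u(0)-p\|$ for $t\ge0$;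 (iii) every solution $u$ on $(-\infty,0]$ that stays in $U$ satisfies $\langle Q(u(0)-p),u(0)-p\rangle\ge 0$ and $\|u(t)-p\|\le Ce^{lt}\|u(0)-p\|$ for $t\le0$. Theorem. There exist $\nu_-<0<\nu_+$ such that a pitchfork bifurcation of the origin occurs on $[\nu_-,\nu_+]$, isolated by $$R=[-\sqrt{2\nu_+},\sqrt{2\nu_+}]\times[-\nu_+^{3/2},\nu_+^{3/2}]^2 .$$ That is: (0) for some $\varepsilon>0$ and all $\nu\in[\nu_-,\nu_+]$, $R$ is an $\varepsilon$-isolating cuboid with exit direction $y$: on the two faces $y=\pm\nu_+^{3/2}$ of $R$ the vector field $F_\nu$ points outwards, and on the other four faces it points inwards, in each case with normal speed at least $\varepsilon$; (P1) the origin is a fixed point for all $\nu\in[\nu_-,\nu_+]$, and it is hyperbolic for $\nu\ne0$; (P2) for $\nu\in[\nu_-,0]$ the set $\{0\}$ is the maximal invariant set in $R$; (P3) for $\nu\in(0,\nu_+]$ there are two distinct hyperbolic fixed points $u_-^\nu,u_+^\nu\in R\setminus\{0\}$ and full solutions $\gamma_\pm$ with $\gamma_\pm(t)\to0$ as $t\to-\infty$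 and $\gamma_\pm(t)\to u_\pm^\nu$ as $t\to+\infty$ (heteroclinic connections), such that $\{0,u_-^\nu,u_+^\nu\}\cup\gamma_-(\mathbb R)\cup\gamma_+(\mathbb R)$ is the maximal invariant set in $R$. Moreover, for $\nu\in(0,\nu_+]$ every fixed point in $R\setminus\{0\}$ is a hyperbolic saddle whose linearization has one eigenvalue with positive and two with negative real part, counted with multiplicity. -/

import Mathlib

open Set Filter Topology

noncomputable section

namespace PitchforkModel

/-- The phase space `ℝⁿ` with the Euclidean norm. -/
abbrev Space (n : ℕ) : Type := EuclideanSpace ℝ (Fin n)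

/-- The cuboid `∏ᵢ [a i, b i]`. -/
def cuboid {n : ℕ} (a b : Fin n → ℝ) : Set (Space n) :=
  {u | ∀ i, u i ∈ Icc (a i) (b i)}

/-- `u : ℝ → ℝⁿ` is a full solution of `u' = F(u)`: it is defined and solves the equation for all
times, positive and negative. -/
def IsFullSolution {n : ℕ} (F : Space n → Space n) (u : ℝ → Space n) : Prop :=
  ∀ t, HasDerivAt u (F (u t)) t

/-- `u` solves `u' = F(u)` on `[0, ∞)`. -/
def IsForwardSolution {n : ℕ} (F : Space n → Space n) (u : ℝ → Space n) : Prop :=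
  ∀ t, 0 ≤ t → HasDerivWithinAt u (F (u t)) (Ici 0) t

/-- `u` solves `u' = F(u)` on `(-∞, 0]`. -/
def IsBackwardSolution {n : ℕ} (F : Space n → Space n) (u : ℝ → Space n) : Prop :=
  ∀ t, t ≤ 0 → HasDerivWithinAt u (F (u t)) (Iic 0) t

/-- `I ⊆ S` has the invariance property: a point of `S` belongs to `I` iff there is a full solution
through it and all full solutions through it remain in `I`. -/
def IsInvariantIn {n : ℕ} (F : Space n → Space n) (S I : Set (Space n)) : Prop :=
  I ⊆ S ∧ ∀ p ∈ S, p ∈ I ↔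
    (∃ u, IsFullSolution F u ∧ ∃ s, u s = p) ∧
      ∀ u, IsFullSolution F u → (∃ s, u s = p) → ∀ t, u t ∈ I

/-- `I` is the maximal invariant set in `S`: the largest subset of `S` with the invariance
property. (The property alone does not determine `I`, the empty set always has it.) -/
def IsMaximalInvariant {n : ℕ} (F : Space n → Space n) (S I : Set (Space n)) : Prop :=
  IsGreatest {J | IsInvariantIn F S J} I

/-- A heteroclinic connection from `p` to `q`. -/
structure IsHeteroclinic {n : ℕ} (F : Space n → Space n) (p q : Space n) (γ : ℝ → Space n) :
    Prop where
  ne : p ≠ q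
  full : IsFullSolution F γ
  source : Tendsto γ atBot (𝓝 p)
  target : Tendsto γ atTop (𝓝 q)

/-- `∏ᵢ [a i, b i]` is an `ε`-isolating cuboid for `u' = F(u)`, with exit directions `J`: on the
faces in the directions of `J` the vector field points outwards, and on all other faces it points
inwards, in each case with normal speed at least `ε`. -/
structure IsIsolatingCuboid {n : ℕ} (F : Space n → Space n) (a b : Fin n → ℝ)
    (J : Finset (Fin n)) (ε : ℝ) : Prop where
  pos : 0 < ε
  lt : ∀ i, a i < b i
  exit_right : ∀ u ∈ cuboid a b, ∀ i ∈ J, u i = b i → ε ≤ F u i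
  exit_left : ∀ u ∈ cuboid a b, ∀ i ∈ J, u i = a i → F u i ≤ -ε
  entry_right : ∀ u ∈ cuboid a b, ∀ i ∉ J, u i = b i → F u i ≤ -ε
  entry_left : ∀ u ∈ cuboid a b, ∀ i ∉ J, u i = a i → ε ≤ F u i

/-- The strong cone conditions on `U` for the quadratic form `v ↦ ⟪Q v, v⟫` (`Q` symmetric): for
some `λ > 0` and all small `|δ|`, the forms `Q + δ Id` satisfy
`d/dt ⟪(Q + δ)(u₁ - u₂), u₁ - u₂⟫ ≥ λ ‖u₁ - u₂‖²` along solutions `u₁`, `u₂` in `U`. -/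
def StrongCone {n : ℕ} (F : Space n → Space n) (Q : Space n →L[ℝ] Space n)
    (U : Set (Space n)) : Prop :=
  ∃ l > 0, ∃ δ₀ > 0, ∀ δ : ℝ, |δ| ≤ δ₀ → ∀ z₁ ∈ U, ∀ z₂ ∈ U,
    l * ‖z₁ - z₂‖ ^ 2 ≤ 2 * inner ℝ (Q (z₁ - z₂) + δ • (z₁ - z₂)) (F z₁ - F z₂)

/-- Solutions that remain in `U` forward in time start in the non-positive cone of `Q` at `p` and
converge to `p` exponentially; solutions that remain in `U` backward in time start in the
non-negative cone and converge to `p` exponentially as `t → -∞`. -/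
def ExponentialDichotomy {n : ℕ} (F : Space n → Space n) (p : Space n)
    (Q : Space n →L[ℝ] Space n) (U : Set (Space n)) : Prop :=
  ∃ C > 0, ∃ l > 0,
    (∀ u, IsForwardSolution F u → (∀ t, 0 ≤ t → u t ∈ U) →
      inner ℝ (Q (u 0 - p)) (u 0 - p) ≤ 0 ∧
        ∀ t, 0 ≤ t → ‖u t - p‖ ≤ C * Real.exp (-l * t) * ‖u 0 - p‖) ∧
    (∀ u, IsBackwardSolution F u → (∀ t, t ≤ 0 → u t ∈ U) →
      0 ≤ inner ℝ (Q (u 0 - p)) (u 0 - p) ∧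
        ∀ t, t ≤ 0 → ‖u t - p‖ ≤ C * Real.exp (l * t) * ‖u 0 - p‖)

/-- The complex eigenvalues, with algebraic multiplicity, of the linearization of `F` at `p`. -/
def eigenvaluesAt {n : ℕ} (F : Space n → Space n) (p : Space n) : Multiset ℂ :=
  (fderiv ℝ F p).toLinearMap.charpoly.aroots ℂ

/-- `p` is a hyperbolic fixed point of `u' = F(u)`: in the usual sense (no eigenvalue of the
linearization on the imaginary axis) and in the sense of cones (near `p` the strong cone conditions
and the exponential dichotomy hold for some symmetric quadratic form). -/
structure IsHyperbolic {n : ℕ} (F : Space n → Space n) (p : Space n) : Prop where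
  fixed : F p = 0
  differentiable : DifferentiableAt ℝ F p
  spectral : ∀ μ ∈ eigenvaluesAt F p, μ.re ≠ 0
  cones : ∃ Q : Space n →L[ℝ] Space n, Q.toLinearMap.IsSymmetric ∧
    ∃ U ∈ 𝓝 p, StrongCone F Q U ∧ ExponentialDichotomy F p Q U

/-- Dimension of the unstable space of the linearization at `p`. -/
def unstableDim {n : ℕ} (F : Space n → Space n) (p : Space n) : ℕ :=
  (eigenvaluesAt F p).countP fun μ => 0 < μ.re

/-- Dimension of the stable space of the linearization at `p`. -/
def stableDim {n : ℕ} (F : Space n → Space n) (p : Space n) : ℕ :=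
  (eigenvaluesAt F p).countP fun μ => μ.re < 0

/-- The family `u' = F_ν(u)` undergoes a pitchfork bifurcation of the fixed point `u₀` on
`[ν₋, ν₊]`; the set isolating all dynamics near the bifurcation is `R = ∏ᵢ [a i, b i]`, with exit
directions `J`. -/
structure IsPitchforkBifurcation {n : ℕ} (F : ℝ → Space n → Space n) (νm νp : ℝ)
    (a b : Fin n → ℝ) (J : Finset (Fin n)) (u₀ : Space n) : Prop where
  neg : νm < 0
  pos : 0 < νp
  isolating : ∃ ε, ∀ ν ∈ Icc νm νp, IsIsolatingCuboid (F ν) a b J ε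
  mem : u₀ ∈ cuboid a b
  fixed : ∀ ν ∈ Icc νm νp, F ν u₀ = 0
  hyperbolic : ∀ ν ∈ Icc νm νp, ν ≠ 0 → IsHyperbolic (F ν) u₀
  before : ∀ ν ∈ Icc νm 0, IsMaximalInvariant (F ν) (cuboid a b) {u₀}
  after : ∀ ν ∈ Ioc 0 νp, ∃ um ∈ cuboid a b, ∃ up ∈ cuboid a b,
    um ≠ u₀ ∧ up ≠ u₀ ∧ um ≠ up ∧ IsHyperbolic (F ν) um ∧ IsHyperbolic (F ν) up ∧
      ∃ γm γp : ℝ → Space n,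
        IsHeteroclinic (F ν) u₀ um γm ∧ IsHeteroclinic (F ν) u₀ up γp ∧
          IsMaximalInvariant (F ν) (cuboid a b)
            ({u₀, um, up} ∪ range γm ∪ range γp)

/-- The right-hand side of the model with an extra unstable direction; the coordinates `x, y, z`
are `u 0, u 1, u 2`. -/
def modelField (ν : ℝ) (u : Space 3) : Space 3 :=
  !₂[u 0 * (ν - u 0 ^ 2) + u 0 ^ 3 * (u 1 + u 2) + u 0 * (u 1 ^ 2 + u 2 ^ 2) + u 1 * u 2,
    u 1 + u 0 ^ 2 * (u 1 + u 2) + u 0 ^ 4 + u 1 * u 2,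
    -u 2 + u 0 ^ 2 * (u 1 + u 2) + u 0 ^ 4 + u 1 * u 2]

/-- Half side lengths of `B_ν = [-√(2ν), √(2ν)] × [-ν^(3/2), ν^(3/2)]²`. -/
def halfSides (ν : ℝ) : Fin 3 → ℝ :=
  ![Real.sqrt (2 * ν), ν ^ (3 / 2 : ℝ), ν ^ (3 / 2 : ℝ)]

end PitchforkModel

end

namespace PitchforkModel

/-! ### Differential inequalities -/

/-! In the box the `y`-equation expands and the `z`-equation contracts at nearly unit rate, while
`x` is slow and all couplings are weak. The quadratic quantity `y² - z²/2 - m²` grows exponentially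
if it is ever positive, so boundedness keeps it nonpositive; time reversal gives the same with `y`
and `z` exchanged. With `m = x³`, full orbits in the box satisfy `|y|, |z| ≤ 3/2 |x|³`. With `m` the
difference of the `x`-coordinates of two such orbits, the orbits in the box lie on one Lipschitz
graph over the `x`-axis (`IsOrbit.abs_le_cube`, `IsOrbit.abs_sub_le`). This graph does the work of a
centre manifold.

On the graph the dynamics is that of `x' = x(ν - x²)` up to small errors. For `ν ≤ 0`, `(x²)' ≤
-x⁴`, and only the origin survives backward in time (`two_mul_slowRate_le`). For `ν > 0` each half
`σx > 0`, `σ = ±1`, contains an equilibrium at distance `a` (`exists_equilibrium`), and `(a - x)x' ≥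
½ x a (a - x)²` (`logistic_le_slowRate`): orbits beyond `a` are unbounded backward, those between
run from `0` to `a`. The field is not equivariant under `x ↦ -x`, since the term `yz` changes sign
relative to the others; the factor `σ` in `slowRate` records this, so that both halves are treated
at once.

The connecting orbit comes from a Lyapunov–Perron fixed point for the truncated field
(`exists_isSlowTrajectory`). Uniqueness on the graph prevents it from crossing `0` or `a`, so the
truncation is never felt. Any other orbit over `(0, a)` shares an `x`-value with it and is therefore
a time shift of it (`exists_branch`).

Hyperbolicity reduces to a symmetric `Q` with `⟪Qv, Av⟫ ≥ l‖v‖²` for the linearization `A`: strict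
differentiability yields the cone conditions, and these yield the dichotomy
(`isHyperbolic_of_coercive`). The spectrum is located by sign changes of the characteristic
polynomial. -/

/-- Grönwall's inequality in monotone form. The sign of `c` is free: positive `c` is used for
growth, negative `c` for decay. -/
lemma monotoneOn_exp_mul {V V' : ℝ → ℝ} {c a : ℝ} (hV : ContinuousOn V (Ici a))
    (hd : ∀ t, a < t → HasDerivAt V (V' t) t) (h : ∀ t, a < t → c * V t ≤ V' t) :
    MonotoneOn (fun t => Real.exp (-c * t) * V t) (Ici a) := by
  have hD : ∀ t, a < t → HasDerivAt (fun t => Real.exp (-c * t) * V t)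
      (Real.exp (-c * t) * (-c) * V t + Real.exp (-c * t) * V' t) t := fun t ht => by
    have h1 : HasDerivAt (fun t => -c * t) (-c) t := by
      simpa using (hasDerivAt_id t).const_mul (-c)
    exact h1.exp.mul (hd t ht)
  refine monotoneOn_of_deriv_nonneg (convex_Ici a) ?_ ?_ ?_
  · exact (by fun_prop : Continuous fun t => Real.exp (-c * t)).continuousOn.mul hV
  · intro t ht
    rw [interior_Ici] at ht
    exact (hD t ht).differentiableAt.differentiableWithinAt
  · intro t ht
    rw [interior_Ici] at ht
    rw [(hD t ht).deriv]
    have := mul_nonneg (Real.exp_pos (-c * t)).le (sub_nonneg.2 (h t ht))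
    linarith

/-- A positive value would grow at least like `exp (c t)` and exceed `B`. Unwanted bounded orbits
are excluded by this mechanism. -/
lemma nonpos_of_mul_le_deriv {V V' : ℝ → ℝ} {c a B : ℝ} (hc : 0 < c)
    (hV : ContinuousOn V (Ici a)) (hd : ∀ t, a < t → HasDerivAt V (V' t) t)
    (h : ∀ t, a < t → c * V t ≤ V' t) (hB : ∀ t, a ≤ t → V t ≤ B) {t : ℝ} (ht : a ≤ t) :
    V t ≤ 0 := by
  have hm := monotoneOn_exp_mul hV hd h
  have h0 : Tendsto (fun s => Real.exp (-c * s) * B) atTop (𝓝 0) := by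
    have : Tendsto (fun s => Real.exp (-c * s)) atTop (𝓝 0) := by
      refine Real.tendsto_exp_atBot.comp ?_
      exact tendsto_id.const_mul_atTop_of_neg (by linarith)
    simpa using this.mul_const B
  have : Real.exp (-c * t) * V t ≤ 0 := by
    refine ge_of_tendsto h0 ?_
    filter_upwards [eventually_ge_atTop t] with s hs
    exact (hm ht (ht.trans hs) hs).trans
      (mul_le_mul_of_nonneg_left (hB s (ht.trans hs)) (Real.exp_pos _).le)
  by_contra hcon
  exact absurd this (not_le.2 (mul_pos (Real.exp_pos _) (not_le.1 hcon)))

/-- A bounded function on the line that grows at least at rate `c` is nonpositive. -/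
lemma nonpos_of_forall_mul_le_deriv {V V' : ℝ → ℝ} {c B : ℝ} (hc : 0 < c)
    (hd : ∀ t, HasDerivAt V (V' t) t) (h : ∀ t, c * V t ≤ V' t) (hB : ∀ t, V t ≤ B) (t : ℝ) :
    V t ≤ 0 :=
  nonpos_of_mul_le_deriv (a := t) hc
    (fun s _ => (hd s).continuousAt.continuousWithinAt) (fun s _ => hd s) (fun s _ => h s)
    (fun s _ => hB s) le_rfl

lemma hasDerivAt_comp_neg {V V' : ℝ → ℝ} (hd : ∀ t, HasDerivAt V (V' t) t) (t : ℝ) :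
    HasDerivAt (fun s => V (-s)) (-V' (-t)) t := by
  have := (hd (-t)).comp t (hasDerivAt_neg t)
  rw [mul_neg_one] at this
  exact this

/-- Two directions, one expanding and one contracting at unit rate, are slaved to a third
quantity `m` along bounded trajectories if all couplings are weak. -/
lemma sq_le_of_expanding_contracting {m y z m' g h : ℝ → ℝ} {B : ℝ}
    (hm : ∀ t, HasDerivAt m (m' t) t) (hy : ∀ t, HasDerivAt y (y t + g t) t)
    (hz : ∀ t, HasDerivAt z (-z t + h t) t) (hB : ∀ t, |y t| ≤ B)
    (hm' : ∀ t, |m' t| ≤ 1 / 32 * (|m t| + |y t| + |z t|))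
    (hg : ∀ t, |g t| ≤ 1 / 32 * (|m t| + |y t| + |z t|))
    (hh : ∀ t, |h t| ≤ 1 / 32 * (|m t| + |y t| + |z t|)) (t : ℝ) :
    y t ^ 2 ≤ z t ^ 2 / 2 + m t ^ 2 := by
  suffices y t ^ 2 - z t ^ 2 / 2 - m t ^ 2 ≤ 0 by linarith
  -- Without couplings `V' - V = y² + 3/2 z² + m²`, which is positive definite and absorbs the
  -- coupling terms. Only `y` has to be bounded, since `V ≤ y²`.
  refine nonpos_of_forall_mul_le_deriv (V := fun t => y t ^ 2 - z t ^ 2 / 2 - m t ^ 2)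
    (V' := fun t => 2 * y t * (y t + g t) - z t * (-z t + h t) - 2 * m t * m' t) (c := 1)
    (B := B ^ 2) one_pos ?_ ?_ ?_ t
  · intro t
    refine ((((hy t).pow 2).sub (((hz t).pow 2).div_const 2)).sub ((hm t).pow 2)).congr_deriv ?_
    push_cast
    ring
  · intro t
    have h1 := abs_le.1 ((abs_mul (y t) (g t)).le.trans
      (mul_le_mul_of_nonneg_left (hg t) (abs_nonneg _)))
    have h2 := abs_le.1 ((abs_mul (z t) (h t)).le.trans
      (mul_le_mul_of_nonneg_left (hh t) (abs_nonneg _)))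
    have h3 := abs_le.1 ((abs_mul (m t) (m' t)).le.trans
      (mul_le_mul_of_nonneg_left (hm' t) (abs_nonneg _)))
    have e1 := sq_abs (y t)
    have e2 := sq_abs (z t)
    have e3 := sq_abs (m t)
    nlinarith [sq_nonneg (|y t| - |z t|), sq_nonneg (|y t| - |m t|), sq_nonneg (|m t| - |z t|)]
  · intro t
    have := abs_le.1 (hB t)
    nlinarith [sq_nonneg (z t), sq_nonneg (m t)]

/-- Time reversal exchanges the expanding and the contracting variable. From `y² ≤ z²/2 + m²` and
`z² ≤ y²/2 + m²` follows `y², z² ≤ 2m²`, and `2 ≤ (3/2)²`. -/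
lemma abs_le_of_expanding_contracting {m y z m' g h : ℝ → ℝ} {B : ℝ}
    (hm : ∀ t, HasDerivAt m (m' t) t) (hy : ∀ t, HasDerivAt y (y t + g t) t)
    (hz : ∀ t, HasDerivAt z (-z t + h t) t) (hBy : ∀ t, |y t| ≤ B) (hBz : ∀ t, |z t| ≤ B)
    (hm' : ∀ t, |m' t| ≤ 1 / 32 * (|m t| + |y t| + |z t|))
    (hg : ∀ t, |g t| ≤ 1 / 32 * (|m t| + |y t| + |z t|))
    (hh : ∀ t, |h t| ≤ 1 / 32 * (|m t| + |y t| + |z t|)) (t : ℝ) :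
    |y t| ≤ 3 / 2 * |m t| ∧ |z t| ≤ 3 / 2 * |m t| := by
  have h1 := sq_le_of_expanding_contracting hm hy hz hBy hm' hg hh t
  have h2 := sq_le_of_expanding_contracting (m := fun s => m (-s)) (y := fun s => z (-s))
    (z := fun s => y (-s)) (m' := fun s => -m' (-s)) (g := fun s => -h (-s))
    (h := fun s => -g (-s)) (B := B)
    (hasDerivAt_comp_neg hm)
    (fun s => by convert hasDerivAt_comp_neg hz s using 1; ring)
    (fun s => by convert hasDerivAt_comp_neg hy s using 1; ring)
    (fun s => hBz _) (fun s => by rw [abs_neg]; linarith [hm' (-s)])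
    (fun s => by rw [abs_neg]; linarith [hh (-s)]) (fun s => by rw [abs_neg]; linarith [hg (-s)])
    (-t)
  simp only [neg_neg] at h2
  constructor <;>
  · rw [← sq_le_sq₀ (abs_nonneg _) (by positivity), mul_pow, sq_abs, sq_abs]
    nlinarith [sq_nonneg (m t)]

/-! ### Uniqueness of solutions and maximal invariant sets -/

lemma IsFullSolution.shift {n : ℕ} {F : Space n → Space n} {u : ℝ → Space n}
    (hu : IsFullSolution F u) (s : ℝ) : IsFullSolution F fun t => u (t + s) :=
  fun t => (hu (t + s)).comp_add_const t s

lemma isFullSolution_const {n : ℕ} {F : Space n → Space n} {p : Space n} (hp : F p = 0) :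
    IsFullSolution F fun _ => p := fun t => by
  simpa [hp] using hasDerivAt_const t p

/-- The coincidence set is closed by continuity and open by local uniqueness, a `C¹` field being
locally Lipschitz. -/
lemma IsFullSolution.eq_of_eq {n : ℕ} {F : Space n → Space n} (hF : ContDiff ℝ 1 F)
    {u v : ℝ → Space n} (hu : IsFullSolution F u) (hv : IsFullSolution F v) {s : ℝ}
    (h : u s = v s) : u = v := by
  have hcu : Continuous u := continuous_iff_continuousAt.2 fun t => (hu t).continuousAt
  have hcv : Continuous v := continuous_iff_continuousAt.2 fun t => (hv t).continuousAt
  have hclopen : IsClopen {t | u t = v t} := by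
    refine ⟨isClosed_eq hcu hcv, isOpen_iff_mem_nhds.2 fun t ht => ?_⟩
    obtain ⟨K, S, hS, hK⟩ := (hF.contDiffAt (x := u t)).exists_lipschitzOnWith
    have ht' : u t = v t := ht
    exact ODE_solution_unique_of_eventually (v := fun _ => F) (s := fun _ => S) (K := K)
      (Eventually.of_forall fun _ => hK)
      ((hcu.continuousAt.eventually hS).mono fun r hr => ⟨hu r, hr⟩)
      ((hcv.continuousAt.eventually (ht' ▸ hS)).mono fun r hr => ⟨hv r, hr⟩) ht
  have := hclopen.eq_univ ⟨s, h⟩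
  funext t
  exact (this ▸ mem_univ t : t ∈ {t | u t = v t})

/-- By uniqueness at most one full orbit passes through a point, so "some" and "every" full solution
agree. It remains to check that `I` consists of full orbits and catches every full orbit that stays
in `S`. -/
lemma isMaximalInvariant_of_forall {n : ℕ} {F : Space n → Space n} (hF : ContDiff ℝ 1 F)
    {S I : Set (Space n)} (hIS : I ⊆ S)
    (hex : ∀ p ∈ I, ∃ u, IsFullSolution F u ∧ (∃ s, u s = p) ∧ ∀ t, u t ∈ I)
    (hmax : ∀ u, IsFullSolution F u → (∀ t, u t ∈ S) → u 0 ∈ I) :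
    IsMaximalInvariant F S I := by
  refine ⟨⟨hIS, fun p hp => ⟨fun hpI => ?_, fun ⟨⟨u, hu, s, hs⟩, h⟩ => ?_⟩⟩, fun J hJ p hp => ?_⟩
  · obtain ⟨u, hu, ⟨s, hs⟩, hI⟩ := hex p hpI
    refine ⟨⟨u, hu, s, hs⟩, fun v hv ⟨r, hr⟩ t => ?_⟩
    have h1 := IsFullSolution.eq_of_eq hF (hv.shift r) (hu.shift s) (s := 0) (by simp [hr, hs])
    have h2 := congrFun h1 (t - r)
    simp only [sub_add_cancel] at h2
    rw [h2]
    exact hI _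
  · exact hs ▸ h u hu ⟨s, hs⟩ s
  · obtain ⟨⟨u, hu, s, hs⟩, h⟩ := (hJ.2 p (hJ.1 hp)).1 hp
    have := hmax _ (hu.shift s) fun t => hJ.1 (h u hu ⟨s, hs⟩ (t + s))
    simpa [hs] using this

/-! ### Hyperbolicity from a quadratic form -/

section Cones

variable {n : ℕ} {F : Space n → Space n} {p : Space n} {Q : Space n →L[ℝ] Space n}
  {U : Set (Space n)}

/-- Strict differentiability replaces `F z₁ - F z₂` by `A (z₁ - z₂)` uniformly in both points. The
choices of `ε` and `δ₀` let the remainder and the `δ`-term cost `l/4` each, leaving `2(l - l/2) =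
l`. The ball of radius 1 makes `U` bounded, which the dichotomy needs. -/
lemma exists_strongCone_of_hasStrictFDerivAt {A : Space n →L[ℝ] Space n}
    (hA : HasStrictFDerivAt F A p) {l : ℝ} (hl : 0 < l)
    (h : ∀ v, l * ‖v‖ ^ 2 ≤ inner ℝ (Q v) (A v)) :
    ∃ U ∈ 𝓝 p, StrongCone F Q U ∧ ∀ z ∈ U, ‖z - p‖ ≤ 1 := by
  set ε : ℝ := l / (4 * (‖Q‖ + 1)) with hε
  have hε0 : 0 < ε := by positivity
  set δ₀ : ℝ := l / (4 * (‖A‖ + ε)) with hδ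
  have hδ0 : 0 < δ₀ := by positivity
  obtain ⟨s, hs, hs'⟩ := hA.approximates_deriv_on_nhds (c := ⟨ε, hε0.le⟩) (Or.inr hε0)
  refine ⟨s ∩ Metric.closedBall p 1, inter_mem hs (Metric.closedBall_mem_nhds p one_pos),
    ⟨l, hl, δ₀, hδ0, fun δ hδle z₁ h₁ z₂ h₂ => ?_⟩, fun z hz => by
      simpa [dist_eq_norm] using hz.2⟩
  have hE : ‖F z₁ - F z₂ - A (z₁ - z₂)‖ ≤ ε * ‖z₁ - z₂‖ := hs' z₁ h₁.1 z₂ h₂.1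
  set v := z₁ - z₂
  set e := F z₁ - F z₂ - A v
  have hF : F z₁ - F z₂ = A v + e := by simp [e]
  have h1 := abs_le.1 ((abs_real_inner_le_norm (Q v) e).trans
    (mul_le_mul (Q.le_opNorm v) hE (norm_nonneg _) (by positivity)))
  have h2 : |inner ℝ (δ • v) (A v + e)| ≤ δ₀ * ‖v‖ * (‖A‖ * ‖v‖ + ε * ‖v‖) := by
    refine (abs_real_inner_le_norm _ _).trans (mul_le_mul ?_ ?_ (norm_nonneg _) (by positivity))
    · rw [norm_smul, Real.norm_eq_abs]; gcongr
    · exact (norm_add_le _ _).trans (add_le_add (A.le_opNorm v) hE)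
  have h3 := abs_le.1 h2
  have e1 : ‖Q‖ * ‖v‖ * (ε * ‖v‖) ≤ l / 4 * ‖v‖ ^ 2 := by
    have : ‖Q‖ * ε ≤ l / 4 := by
      rw [hε, mul_div_assoc', div_le_div_iff₀ (by positivity) (by norm_num)]
      nlinarith [norm_nonneg Q]
    nlinarith [sq_nonneg ‖v‖]
  have e2 : δ₀ * ‖v‖ * (‖A‖ * ‖v‖ + ε * ‖v‖) = l / 4 * ‖v‖ ^ 2 := by
    rw [hδ]
    have : ‖A‖ + ε ≠ 0 := by positivity
    field_simp
  rw [hF, inner_add_left, inner_add_right]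
  linarith [h v, h1.1, h3.1]

lemma hasDerivAt_inner_quadratic (hQ : Q.toLinearMap.IsSymmetric) {u : ℝ → Space n}
    {u' : Space n} {t : ℝ} (hu : HasDerivAt u u' t) (δ : ℝ) :
    HasDerivAt (fun s => inner ℝ (Q (u s - p) + δ • (u s - p)) (u s - p))
      (2 * inner ℝ (Q (u t - p) + δ • (u t - p)) u') t := by
  have h1 : HasDerivAt (fun s => u s - p) u' t := hu.sub_const p
  have h2 : HasDerivAt (fun s => Q (u s - p) + δ • (u s - p)) (Q u' + δ • u') t :=
    (Q.hasFDerivAt.comp_hasDerivAt t h1).add (h1.const_smul δ)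
  refine (h2.inner ℝ h1).congr_deriv ?_
  have : inner ℝ (Q u') (u t - p) = inner ℝ (Q (u t - p)) u' := by
    rw [real_inner_comm]
    exact (hQ (u t - p) u').symm
  rw [inner_add_left, inner_add_left, inner_smul_left, inner_smul_left, this,
    real_inner_comm u' (u t - p)]
  simp only [conj_trivial]
  ring

/-- Along `u` the form `V δ` of `Q + δ` satisfies `V δ' ≥ (l/K)|V δ|`, so boundedness forces `V δ ≤
0` for every admissible `δ`. At `δ = δ₀` this reads `δ₀‖u - p‖² ≤ -V 0`, while the growth inequality
at `δ = 0` makes `-V 0` decay exponentially. -/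
lemma forward_decay_of_cone (hQ : Q.toLinearMap.IsSymmetric) (hp : F p = 0) (hpU : p ∈ U)
    {r : ℝ} (hU : ∀ z ∈ U, ‖z - p‖ ≤ r) {l δ₀ : ℝ} (hl : 0 < l) (hδ₀ : 0 < δ₀)
    (h : ∀ δ : ℝ, |δ| ≤ δ₀ → ∀ z₁ ∈ U, ∀ z₂ ∈ U,
      l * ‖z₁ - z₂‖ ^ 2 ≤ 2 * inner ℝ (Q (z₁ - z₂) + δ • (z₁ - z₂)) (F z₁ - F z₂))
    {u : ℝ → Space n} (hu : IsForwardSolution F u) (huU : ∀ t, 0 ≤ t → u t ∈ U) :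
    inner ℝ (Q (u 0 - p)) (u 0 - p) ≤ 0 ∧
      ∀ t, 0 ≤ t → ‖u t - p‖ ≤ Real.sqrt ((‖Q‖ + δ₀) / δ₀) *
        Real.exp (-(l / (‖Q‖ + δ₀) / 2) * t) * ‖u 0 - p‖ := by
  set K := ‖Q‖ + δ₀ with hK
  have hK0 : 0 < K := by positivity
  have hcu : ContinuousOn u (Ici 0) := fun t ht => (hu t ht).continuousWithinAt
  have hdu : ∀ t, 0 < t → HasDerivAt u (F (u t)) t := fun t ht =>
    (hu t ht.le).hasDerivAt (Ici_mem_nhds ht)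
  let V : ℝ → ℝ → ℝ := fun δ s => inner ℝ (Q (u s - p) + δ • (u s - p)) (u s - p)
  have hVc : ∀ δ, ContinuousOn (V δ) (Ici 0) := fun δ => by
    have h1 : ContinuousOn (fun s => u s - p) (Ici 0) := hcu.sub continuousOn_const
    exact ((Q.continuous.comp_continuousOn h1).add (h1.const_smul δ)).inner h1
  have hVd : ∀ δ t, 0 < t → HasDerivAt (V δ)
      (2 * inner ℝ (Q (u t - p) + δ • (u t - p)) (F (u t))) t := fun δ t ht =>
    hasDerivAt_inner_quadratic hQ (hdu t ht) δ
  have hVK : ∀ δ t, |δ| ≤ δ₀ → |V δ t| ≤ K * ‖u t - p‖ ^ 2 := fun δ t hδ => by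
    refine (abs_real_inner_le_norm _ _).trans ?_
    have : ‖Q (u t - p) + δ • (u t - p)‖ ≤ K * ‖u t - p‖ := by
      refine (norm_add_le _ _).trans ?_
      rw [norm_smul, Real.norm_eq_abs, hK, add_mul]
      exact add_le_add (Q.le_opNorm _) (by gcongr)
    calc _ ≤ K * ‖u t - p‖ * ‖u t - p‖ := by gcongr
      _ = _ := by ring
  have hgrow : ∀ δ t, |δ| ≤ δ₀ → 0 < t →
      l / K * |V δ t| ≤ 2 * inner ℝ (Q (u t - p) + δ • (u t - p)) (F (u t)) := fun δ t hδ ht => by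
    have h1 := h δ hδ (u t) (huU t ht.le) p hpU
    rw [hp, sub_zero] at h1
    refine le_trans ?_ h1
    calc l / K * |V δ t| ≤ l / K * (K * ‖u t - p‖ ^ 2) := by gcongr; exact hVK δ t hδ
      _ = _ := by field_simp
  have hc : 0 < l / K := by positivity
  have hneg : ∀ δ t, |δ| ≤ δ₀ → 0 ≤ t → V δ t ≤ 0 := fun δ t hδ ht =>
    nonpos_of_mul_le_deriv (B := K * r ^ 2) hc (hVc δ) (hVd δ)
      (fun s hs => (mul_le_mul_of_nonneg_left (le_abs_self _) hc.le).trans (hgrow δ s hδ hs))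
      (fun s hs => (le_abs_self _).trans ((hVK δ s hδ).trans (by
        have := hU _ (huU s hs)
        gcongr))) ht
  have hz : |(0 : ℝ)| ≤ δ₀ := by simpa using hδ₀.le
  have hV0 : ∀ t, V 0 t = inner ℝ (Q (u t - p)) (u t - p) := fun t => by simp [V]
  refine ⟨hV0 0 ▸ hneg 0 0 hz le_rfl, fun t ht => ?_⟩
  -- Negative rate: `V 0' ≥ -(l/K) V 0`, so `-V 0` decays like `exp (-(l/K) t)`; the norm decays at
  -- half that rate.
  have hmono := monotoneOn_exp_mul (c := -(l / K)) (hVc 0) (hVd 0) (fun s hs => by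
    have := hgrow 0 s hz hs
    have h2 := mul_le_mul_of_nonneg_left (neg_le_abs (V 0 s)) hc.le
    linarith) (mem_Ici.2 le_rfl) (mem_Ici.2 ht) ht
  simp only [mul_zero, Real.exp_zero, one_mul, neg_neg] at hmono
  have hδt := hneg δ₀ t (abs_of_pos hδ₀).le ht
  have hsplit : V δ₀ t = V 0 t + δ₀ * ‖u t - p‖ ^ 2 := by
    simp only [V, inner_add_left, inner_smul_left, conj_trivial,
      real_inner_self_eq_norm_sq]
    ring
  have hb := (abs_le.1 (hVK 0 0 hz)).1
  have hexp : Real.exp (l / K * t) * Real.exp (-(l / K / 2) * t) ^ 2 = 1 := by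
    rw [← Real.exp_nat_mul, ← Real.exp_add, Real.exp_eq_one_iff]
    push_cast; ring
  have hmain : δ₀ * ‖u t - p‖ ^ 2 ≤
      Real.exp (-(l / K / 2) * t) ^ 2 * (K * ‖u 0 - p‖ ^ 2) := by
    have h1 : -V 0 t * Real.exp (l / K * t) ≤ K * ‖u 0 - p‖ ^ 2 := by linarith
    have h2 := mul_le_mul_of_nonneg_left h1 (sq_nonneg (Real.exp (-(l / K / 2) * t)))
    have h3 : Real.exp (-(l / K / 2) * t) ^ 2 * (-V 0 t * Real.exp (l / K * t)) = -V 0 t := by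
      linear_combination -V 0 t * hexp
    linarith
  rw [← sq_le_sq₀ (norm_nonneg _) (by positivity), mul_pow, mul_pow, Real.sq_sqrt (by positivity)]
  calc ‖u t - p‖ ^ 2 = δ₀ * ‖u t - p‖ ^ 2 / δ₀ := by field_simp
    _ ≤ Real.exp (-(l / K / 2) * t) ^ 2 * (K * ‖u 0 - p‖ ^ 2) / δ₀ := by gcongr
    _ = _ := by ring

/-- Backward solutions of `F` are forward solutions of `-F`, for which `-Q` satisfies the cone
conditions with `δ` replaced by `-δ`; hence both signs of `δ` are needed. -/
lemma StrongCone.exponentialDichotomy (hQ : Q.toLinearMap.IsSymmetric) (hp : F p = 0)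
    (hpU : p ∈ U) {r : ℝ} (hU : ∀ z ∈ U, ‖z - p‖ ≤ r) (h : StrongCone F Q U) :
    ExponentialDichotomy F p Q U := by
  obtain ⟨l, hl, δ₀, hδ₀, h⟩ := h
  refine ⟨Real.sqrt ((‖Q‖ + δ₀) / δ₀), by positivity, l / (‖Q‖ + δ₀) / 2, by positivity,
    fun u hu huU => forward_decay_of_cone hQ hp hpU hU hl hδ₀ h hu huU, fun u hu huU => ?_⟩
  have hQ' : (-Q).toLinearMap.IsSymmetric := fun x y => by
    have := hQ x y
    simpa using this
  have hrev : IsForwardSolution (fun z => -F z) fun t => u (-t) := fun t ht => by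
    have h1 := (hu (-t) (by linarith)).scomp t ((hasDerivAt_neg t).hasDerivWithinAt (s := Ici 0))
      (fun s hs => by simpa using hs)
    simpa [Function.comp_def] using h1
  have key := forward_decay_of_cone (F := fun z => -F z) hQ' (by simp [hp]) hpU hU hl hδ₀
    (fun δ hδ z₁ h₁ z₂ h₂ => by
      have h1 := h (-δ) (by rwa [abs_neg]) z₁ h₁ z₂ h₂
      have e1 : -Q (z₁ - z₂) + δ • (z₁ - z₂) = -(Q (z₁ - z₂) + (-δ) • (z₁ - z₂)) := by
        rw [neg_smul]; abel
      have e2 : -F z₁ - -F z₂ = -(F z₁ - F z₂) := by abel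
      rw [neg_apply, e1, e2, inner_neg_neg]
      exact h1) hrev (fun t ht => huU _ (by linarith))
  simp only [neg_zero, neg_apply, inner_neg_left, norm_neg] at key
  refine ⟨by linarith [key.1], fun t ht => ?_⟩
  have := key.2 (-t) (by linarith)
  simpa using this

lemma isHyperbolic_of_coercive {A : Space n →L[ℝ] Space n} (hp : F p = 0)
    (hA : HasStrictFDerivAt F A p) (hspec : ∀ μ ∈ eigenvaluesAt F p, μ.re ≠ 0)
    (hQ : Q.toLinearMap.IsSymmetric) {l : ℝ} (hl : 0 < l)
    (h : ∀ v, l * ‖v‖ ^ 2 ≤ inner ℝ (Q v) (A v)) : IsHyperbolic F p := by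
  obtain ⟨U, hU, hcone, hbdd⟩ := exists_strongCone_of_hasStrictFDerivAt hA hl h
  exact ⟨hp, hA.hasFDerivAt.differentiableAt, hspec, Q, hQ, U, hU, hcone,
    hcone.exponentialDichotomy hQ hp (mem_of_mem_nhds hU) hbdd⟩

end Cones

/-! ### Slow trajectories of a weakly coupled system by the Lyapunov–Perron method -/

open MeasureTheory

lemma integrableOn_exp_neg_mul {g : ℝ → ℝ} {M : ℝ} (hg : Continuous g) (hM : ∀ t, |g t| ≤ M) :
    IntegrableOn (fun r => Real.exp (-r) * g r) (Ioi 0) := by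
  refine ((integrableOn_exp_neg_Ioi 0).mul_const M).mono' ?_ ?_
  · exact (by fun_prop : Continuous fun r => Real.exp (-r) * g r).aestronglyMeasurable
  · refine Eventually.of_forall fun r => ?_
    rw [Real.norm_eq_abs, abs_mul, Real.abs_exp]
    exact mul_le_mul_of_nonneg_left (hM r) (Real.exp_pos _).le

/-- The only solution of `y' = y + g` that grows slower than `exp`. -/
lemma eq_neg_integral_of_hasDerivAt {y g : ℝ → ℝ} {M : ℝ} (hg : Continuous g)
    (hM : ∀ t, |g t| ≤ M) (hy : ∀ t, HasDerivAt y (y t + g t) t) {t : ℝ}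
    (h0 : Tendsto (fun r => Real.exp (-r) * y (t + r)) atTop (𝓝 0)) :
    y t = -∫ r in Ioi (0 : ℝ), Real.exp (-r) * g (t + r) := by
  have hd : ∀ r ∈ Ici (0 : ℝ), HasDerivAt (fun r => Real.exp (-r) * y (t + r))
      (Real.exp (-r) * g (t + r)) r := fun r _ => by
    refine (((hasDerivAt_neg r).exp).mul ((hy (t + r)).comp_const_add t r)).congr_deriv ?_
    ring
  rw [integral_Ioi_of_hasDerivAt_of_tendsto' hd
    (integrableOn_exp_neg_mul (hg.comp (continuous_const_add t)) fun r => hM _) h0]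
  simp

/-- Instead of differentiating under the integral, an explicit solution of `y' = y + g` is written
down. The constant `c` removes its `exp` component, so the integral formula for slowly growing
solutions identifies the two. -/
lemma hasDerivAt_neg_integral {g : ℝ → ℝ} {M : ℝ} (hg : Continuous g) (hM : ∀ t, |g t| ≤ M)
    (t : ℝ) : HasDerivAt (fun t => -∫ r in Ioi (0 : ℝ), Real.exp (-r) * g (t + r))
      ((-∫ r in Ioi (0 : ℝ), Real.exp (-r) * g (t + r)) + g t) t := by
  set c := ∫ s in Ioi (0 : ℝ), Real.exp (-s) * g s
  let y : ℝ → ℝ := fun t => Real.exp t * ((∫ s in (0 : ℝ)..t, Real.exp (-s) * g s) - c)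
  have hcont : Continuous fun s => Real.exp (-s) * g s := by fun_prop
  have hy : ∀ t, HasDerivAt y (y t + g t) t := fun t => by
    have h1 : HasDerivAt (fun t => (∫ s in (0 : ℝ)..t, Real.exp (-s) * g s) - c)
        (Real.exp (-t) * g t) t := (hcont.integral_hasStrictDerivAt 0 t).hasDerivAt.sub_const c
    refine ((Real.hasDerivAt_exp t).mul h1).congr_deriv ?_
    have : Real.exp t * Real.exp (-t) = 1 := by rw [← Real.exp_add]; simp
    simp only [y]
    linear_combination g t * this
  have heq : (fun t => -∫ r in Ioi (0 : ℝ), Real.exp (-r) * g (t + r)) = y := by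
    funext t
    refine (eq_neg_integral_of_hasDerivAt hg hM hy ?_).symm
    have h1 := ((intervalIntegral_tendsto_integral_Ioi 0 (integrableOn_exp_neg_mul hg hM)
      (tendsto_atTop_add_const_left atTop t tendsto_id)).sub_const c).const_mul (Real.exp t)
    rw [sub_self, mul_zero] at h1
    refine h1.congr fun r => ?_
    simp only [y, id, ← mul_assoc, ← Real.exp_add]
    congr 2
    ring
  have := hy t
  rw [← heq] at this
  exact this

/-- The weight `exp (|t|/2)` is the choice behind the whole contraction argument: its rate is below
1, so the integrals against `exp (-r)` converge, and positive, so that integrating the slow equation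
costs only a constant. Both costs are the factor 2. -/
lemma abs_integral_exp_neg_mul_le {g : ℝ → ℝ} {t d : ℝ}
    (hd : ∀ r, 0 < r → |g r| ≤ d * Real.exp ((|t| + r) / 2)) :
    |∫ r in Ioi (0 : ℝ), Real.exp (-r) * g r| ≤ 2 * d * Real.exp (|t| / 2) := by
  have hlt : (-1 / 2 : ℝ) < 0 := by norm_num
  have hI := (integrableOn_exp_mul_Ioi hlt 0).const_mul (d * Real.exp (|t| / 2))
  have := norm_integral_le_of_norm_le (f := fun r => Real.exp (-r) * g r) hI
    ((ae_restrict_iff' measurableSet_Ioi).2 (Eventually.of_forall fun r hr => by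
      rw [Real.norm_eq_abs, abs_mul, Real.abs_exp]
      refine (mul_le_mul_of_nonneg_left (hd r hr) (Real.exp_pos _).le).trans_eq ?_
      rw [mul_left_comm, mul_assoc, ← Real.exp_add, ← Real.exp_add]
      congr 2
      ring))
  rw [Real.norm_eq_abs, integral_const_mul, integral_exp_mul_Ioi hlt] at this
  refine this.trans_eq ?_
  norm_num
  ring

lemma abs_integral_le_of_le_exp {g : ℝ → ℝ} {t d : ℝ} (hd0 : 0 ≤ d)
    (hd : ∀ s, |g s| ≤ d * Real.exp (|s| / 2)) :
    |∫ s in (0 : ℝ)..t, g s| ≤ 2 * d * Real.exp (|t| / 2) := by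
  have key : ∀ (g : ℝ → ℝ) (t : ℝ), 0 ≤ t → (∀ s, |g s| ≤ d * Real.exp (|s| / 2)) →
      |∫ s in (0 : ℝ)..t, g s| ≤ 2 * d * Real.exp (|t| / 2) := fun g t ht hd => by
    have hF : ∀ s : ℝ, HasDerivAt (fun s => 2 * d * Real.exp (s / 2)) (d * Real.exp (s / 2)) s :=
      fun s => by
        refine ((((hasDerivAt_id s).div_const 2).exp).const_mul (2 * d)).congr_deriv ?_
        simp only [id]
        ring
    have h1 := intervalIntegral.norm_integral_le_of_norm_le (f := g)
      (g := fun s => d * Real.exp (s / 2)) (μ := volume) ht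
      (Eventually.of_forall fun s hs => by
        have := hd s
        rwa [abs_of_pos hs.1] at this)
      (by apply Continuous.intervalIntegrable; fun_prop)
    rw [intervalIntegral.integral_eq_sub_of_hasDerivAt (fun s _ => hF s)
      (by apply Continuous.intervalIntegrable; fun_prop), Real.norm_eq_abs] at h1
    rw [abs_of_nonneg ht]
    refine h1.trans (sub_le_self _ (by positivity))
  rcases le_total 0 t with ht | ht
  · exact key g t ht hd
  · have h1 := key (fun s => g (-s)) (-t) (by linarith) fun s => by simpa using hd (-s)
    rw [intervalIntegral.integral_comp_neg, neg_zero, neg_neg, abs_neg,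
      intervalIntegral.integral_symm, abs_neg] at h1
    exact h1

/-- `u = (x, y, z)` solves `x' = f(u)`, `y' = y + g(u)`, `z' = -z + g(u)` and `y`, `z` are
bounded. -/
structure IsSlowTrajectory (f g : ℝ × ℝ × ℝ → ℝ) (u : ℝ → ℝ × ℝ × ℝ) : Prop where
  deriv_fst : ∀ t, HasDerivAt (fun s => (u s).1) (f (u t)) t
  deriv_snd : ∀ t, HasDerivAt (fun s => (u s).2.1) ((u t).2.1 + g (u t)) t
  deriv_trd : ∀ t, HasDerivAt (fun s => (u s).2.2) (-(u t).2.2 + g (u t)) t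
  bounded : ∃ B, ∀ t, |(u t).2.1| ≤ B ∧ |(u t).2.2| ≤ B

/-- The Lyapunov–Perron operator. -/
noncomputable def perron (f g : ℝ × ℝ × ℝ → ℝ) (ξ : ℝ) (u : ℝ → ℝ × ℝ × ℝ) (t : ℝ) : ℝ × ℝ × ℝ :=
  (ξ + ∫ s in (0 : ℝ)..t, f (u s), -∫ r in Ioi (0 : ℝ), Real.exp (-r) * g (u (t + r)),
    ∫ r in Ioi (0 : ℝ), Real.exp (-r) * g (u (t - r)))

section Perron

variable {f g : ℝ × ℝ × ℝ → ℝ} {M ξ : ℝ} {u v : ℝ → ℝ × ℝ × ℝ}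

lemma hasDerivAt_perron_fst (hf : Continuous f) (hu : Continuous u) (t : ℝ) :
    HasDerivAt (fun s => (perron f g ξ u s).1) (f (u t)) t :=
  ((hf.comp hu).integral_hasStrictDerivAt 0 t).hasDerivAt.const_add ξ

lemma hasDerivAt_perron_snd (hg : Continuous g) (hM : ∀ a, |g a| ≤ M) (hu : Continuous u)
    (t : ℝ) : HasDerivAt (fun s => (perron f g ξ u s).2.1)
      ((perron f g ξ u t).2.1 + g (u t)) t :=
  hasDerivAt_neg_integral (hg.comp hu) (fun t => hM (u t)) t

lemma hasDerivAt_perron_trd (hg : Continuous g) (hM : ∀ a, |g a| ≤ M) (hu : Continuous u)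
    (t : ℝ) : HasDerivAt (fun s => (perron f g ξ u s).2.2)
      (-(perron f g ξ u t).2.2 + g (u t)) t := by
  have h1 := hasDerivAt_neg_integral (g := fun s => g (u (-s))) (by fun_prop)
    (fun t => hM (u (-t)))
  have h2 := (hasDerivAt_comp_neg h1 t).neg
  have e : (fun s => (perron f g ξ u s).2.2) =
      -fun s => -∫ r in Ioi (0 : ℝ), Real.exp (-r) * g (u (-(-s + r))) := by
    funext s
    simp [perron, sub_eq_add_neg, add_comm]
  rw [e]
  exact h2.congr_deriv (by simp [perron, sub_eq_add_neg, add_comm])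

lemma continuous_perron (hf : Continuous f) (hg : Continuous g) (hM : ∀ a, |g a| ≤ M)
    (hu : Continuous u) : Continuous (perron f g ξ u) :=
  (continuous_iff_continuousAt.2 fun t =>
      (hasDerivAt_perron_fst (g := g) (ξ := ξ) hf hu t).continuousAt).prodMk
    ((continuous_iff_continuousAt.2 fun t =>
      (hasDerivAt_perron_snd (f := f) (ξ := ξ) hg hM hu t).continuousAt).prodMk
    (continuous_iff_continuousAt.2 fun t =>
      (hasDerivAt_perron_trd (f := f) (ξ := ξ) hg hM hu t).continuousAt))

lemma abs_integral_exp_neg_mul_le_of_bound {g : ℝ → ℝ} (hM : ∀ t, |g t| ≤ M) :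
    |∫ r in Ioi (0 : ℝ), Real.exp (-r) * g r| ≤ M := by
  have := norm_integral_le_of_norm_le (f := fun r => Real.exp (-r) * g r)
    ((integrableOn_exp_neg_Ioi 0).mul_const M)
    (Eventually.of_forall fun r => by
      rw [Real.norm_eq_abs, abs_mul, Real.abs_exp]
      exact mul_le_mul_of_nonneg_left (hM r) (Real.exp_pos _).le)
  rwa [integral_mul_const, integral_exp_neg_Ioi_zero, one_mul] at this

lemma abs_perron_snd_le (hM : ∀ a, |g a| ≤ M) (t : ℝ) : |(perron f g ξ u t).2.1| ≤ M := by
  rw [perron, abs_neg]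
  exact abs_integral_exp_neg_mul_le_of_bound fun r => hM (u (t + r))

lemma abs_perron_trd_le (hM : ∀ a, |g a| ≤ M) (t : ℝ) : |(perron f g ξ u t).2.2| ≤ M :=
  abs_integral_exp_neg_mul_le_of_bound fun r => hM (u (t - r))

lemma norm_perron_le {M₁ : ℝ} (hfM : ∀ a, |f a| ≤ M₁) (hM : ∀ a, |g a| ≤ M) (t : ℝ) :
    ‖perron f g ξ u t‖ ≤ (|ξ| + 2 * M₁ + M) * Real.exp (|t| / 2) := by
  have hM0 : 0 ≤ M := (abs_nonneg _).trans (hM 0)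
  have hM1 : 0 ≤ M₁ := (abs_nonneg _).trans (hfM 0)
  have he : 1 ≤ Real.exp (|t| / 2) := Real.one_le_exp (by positivity)
  have hMe : M ≤ (|ξ| + 2 * M₁ + M) * Real.exp (|t| / 2) := by nlinarith [abs_nonneg ξ]
  refine norm_prod_le_iff.2 ⟨?_, norm_prod_le_iff.2
    ⟨(abs_perron_snd_le hM t).trans hMe, (abs_perron_trd_le hM t).trans hMe⟩⟩
  have h1 := abs_integral_le_of_le_exp (g := fun s => f (u s)) (t := t) hM1 fun s =>
    (hfM (u s)).trans (le_mul_of_one_le_right hM1 (Real.one_le_exp (by positivity)))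
  refine (norm_add_le _ _).trans ?_
  simp only [Real.norm_eq_abs]
  nlinarith [abs_nonneg ξ]

/-- Each component gains `2 · 1/8` in the norm weighted by `exp (-|t|/2)`, so the operator is a
contraction there. -/
lemma norm_perron_sub_le (hfc : Continuous f) (hgc : Continuous g) (hM : ∀ a, |g a| ≤ M)
    (hf : ∀ a b, |f a - f b| ≤ 1 / 8 * ‖a - b‖)
    (hg : ∀ a b, |g a - g b| ≤ 1 / 8 * ‖a - b‖) (hu : Continuous u) (hv : Continuous v) {d : ℝ}
    (hd : ∀ t, ‖u t - v t‖ ≤ d * Real.exp (|t| / 2)) (t : ℝ) :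
    ‖perron f g ξ u t - perron f g ξ v t‖ ≤ d / 2 * Real.exp (|t| / 2) := by
  have hd0 : 0 ≤ d := by
    have := (norm_nonneg _).trans (hd 0)
    simpa using this
  have hI : ∀ w : ℝ → ℝ × ℝ × ℝ, Continuous w →
      IntegrableOn (fun r => Real.exp (-r) * g (w r)) (Ioi 0) := fun w hw =>
    integrableOn_exp_neg_mul (hgc.comp hw) fun r => hM _
  have hgd : ∀ s, |g (u s) - g (v s)| ≤ d / 8 * Real.exp (|s| / 2) := fun s =>
    (hg _ _).trans (by linarith [hd s])
  have hfin : 2 * (d / 8) * Real.exp (|t| / 2) ≤ d / 2 * Real.exp (|t| / 2) := by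
    have : 0 ≤ d * Real.exp (|t| / 2) := by positivity
    nlinarith
  have hexp : ∀ s r, 0 < r → |s| ≤ |t| + r →
      |g (u s) - g (v s)| ≤ d / 8 * Real.exp ((|t| + r) / 2) := fun s r _ hs =>
    (hgd s).trans (by gcongr)
  refine norm_prod_le_iff.2 ⟨?_, norm_prod_le_iff.2 ⟨?_, ?_⟩⟩
  · refine le_trans ?_ hfin
    have h1 := abs_integral_le_of_le_exp (g := fun s => f (u s) - f (v s)) (t := t)
      (d := d / 8) (by positivity) fun s => (hf _ _).trans (by linarith [hd s])
    have hI : ∀ w : ℝ → ℝ × ℝ × ℝ, Continuous w →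
        IntervalIntegrable (fun s => f (w s)) volume 0 t := fun w hw =>
      (hfc.comp hw).intervalIntegrable _ _
    rw [intervalIntegral.integral_sub (hI u hu) (hI v hv)] at h1
    simpa [perron] using h1
  · refine le_trans ?_ hfin
    have h1 := abs_integral_exp_neg_mul_le (g := fun r => g (u (t + r)) - g (v (t + r))) (t := t)
      (d := d / 8) fun r hr => hexp _ r hr ((abs_add_le _ _).trans (by rw [abs_of_pos hr]))
    simp only [mul_sub] at h1
    rw [integral_sub (hI (fun r => u (t + r)) (by fun_prop))
      (hI (fun r => v (t + r)) (by fun_prop)), abs_sub_comm] at h1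
    simpa [perron, neg_add_eq_sub] using h1
  · refine le_trans ?_ hfin
    have h1 := abs_integral_exp_neg_mul_le (g := fun r => g (u (t - r)) - g (v (t - r))) (t := t)
      (d := d / 8) fun r hr => hexp _ r hr ((abs_sub _ _).trans (by rw [abs_of_pos hr]))
    simp only [mul_sub] at h1
    rw [integral_sub (hI (fun r => u (t - r)) (by fun_prop))
      (hI (fun r => v (t - r)) (by fun_prop))] at h1
    simpa [perron] using h1

lemma IsSlowTrajectory.continuous (h : IsSlowTrajectory f g u) : Continuous u :=
  (continuous_iff_continuousAt.2 fun t => (h.deriv_fst t).continuousAt).prodMk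
    ((continuous_iff_continuousAt.2 fun t => (h.deriv_snd t).continuousAt).prodMk
    (continuous_iff_continuousAt.2 fun t => (h.deriv_trd t).continuousAt))

lemma tendsto_exp_neg_mul_of_bounded {y : ℝ → ℝ} {B : ℝ} (hB : ∀ t, |y t| ≤ B) :
    Tendsto (fun r => Real.exp (-r) * y r) atTop (𝓝 0) := by
  have h1 : Tendsto (fun r => Real.exp (-r) * B) atTop (𝓝 0) := by
    simpa using (Real.tendsto_exp_neg_atTop_nhds_zero).mul_const B
  refine squeeze_zero_norm (fun r => ?_) h1
  rw [Real.norm_eq_abs, abs_mul, Real.abs_exp]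
  exact mul_le_mul_of_nonneg_left (hB r) (Real.exp_pos _).le

/-- Variation of constants: boundedness excludes the homogeneous part `exp t` of `y` at `+∞` and
`exp (-t)` of `z` at `-∞`. -/
lemma IsSlowTrajectory.eq_perron (hfc : Continuous f) (hgc : Continuous g) (hM : ∀ a, |g a| ≤ M)
    (h : IsSlowTrajectory f g u) : perron f g (u 0).1 u = u := by
  obtain ⟨B, hB⟩ := h.bounded
  have hc := h.continuous
  funext t
  refine Prod.ext ?_ (Prod.ext ?_ ?_)
  · rw [perron, intervalIntegral.integral_eq_sub_of_hasDerivAt (fun s _ => h.deriv_fst s)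
      ((hfc.comp hc).intervalIntegrable _ _)]
    ring
  · exact (eq_neg_integral_of_hasDerivAt (hgc.comp hc) (fun s => hM _) h.deriv_snd
      (tendsto_exp_neg_mul_of_bounded fun r => (hB (t + r)).1)).symm
  · have h1 := eq_neg_integral_of_hasDerivAt (y := fun s => (u (-s)).2.2)
      (g := fun s => -g (u (-s))) (t := -t) (M := M) (by fun_prop)
      (fun s => by rw [abs_neg]; exact hM _)
      (fun s => by
        refine (hasDerivAt_comp_neg h.deriv_trd s).congr_deriv ?_
        ring)
      (tendsto_exp_neg_mul_of_bounded fun r => (hB (-(-t + r))).2)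
    simp only [neg_neg, mul_neg, integral_neg, neg_add_eq_sub] at h1
    simpa [perron, sub_eq_add_neg, add_comm] using h1.symm

lemma continuous_of_abs_sub_le (hf : ∀ a b, |f a - f b| ≤ 1 / 8 * ‖a - b‖) : Continuous f := by
  refine (LipschitzWith.of_dist_le_mul (K := 1 / 8) fun a b => ?_).continuous
  rw [Real.dist_eq, dist_eq_norm]
  simpa using hf a b

/-- Slow trajectories are determined by the initial value of the slow variable. -/
lemma IsSlowTrajectory.eq_of_fst_eq {M₁ : ℝ} (hfM : ∀ a, |f a| ≤ M₁) (hM : ∀ a, |g a| ≤ M)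
    (hf : ∀ a b, |f a - f b| ≤ 1 / 8 * ‖a - b‖) (hg : ∀ a b, |g a - g b| ≤ 1 / 8 * ‖a - b‖)
    (hu : IsSlowTrajectory f g u) (hv : IsSlowTrajectory f g v) (h0 : (u 0).1 = (v 0).1) :
    u = v := by
  have hfc := continuous_of_abs_sub_le hf
  have hgc := continuous_of_abs_sub_le hg
  have eu := hu.eq_perron hfc hgc hM
  have ev := hv.eq_perron hfc hgc hM
  rw [← h0] at ev
  set C := |(u 0).1| + 2 * M₁ + M
  -- As values of the Perron operator both trajectories have finite weighted norm; applying the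
  -- operator repeatedly halves their distance each time.
  have key : ∀ (n : ℕ) t, ‖u t - v t‖ ≤ 2 * C * (1 / 2) ^ n * Real.exp (|t| / 2) := fun n => by
    induction n with
    | zero =>
      intro t
      have h1 := norm_perron_le (ξ := (u 0).1) (u := u) hfM hM t
      have h2 := norm_perron_le (ξ := (u 0).1) (u := v) hfM hM t
      rw [eu] at h1
      rw [ev] at h2
      refine (norm_sub_le _ _).trans ?_
      rw [pow_zero]
      linarith
    | succ n ih =>
      intro t
      have h1 := norm_perron_sub_le (ξ := (u 0).1) hfc hgc hM hf hg hu.continuous hv.continuous ih t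
      rw [eu, ev] at h1
      refine h1.trans_eq ?_
      ring
  funext t
  have hlim : Tendsto (fun n : ℕ => 2 * C * (1 / 2 : ℝ) ^ n * Real.exp (|t| / 2)) atTop (𝓝 0) := by
    have := ((tendsto_pow_atTop_nhds_zero_of_lt_one (r := (1 / 2 : ℝ)) (by norm_num)
      (by norm_num)).const_mul (2 * C)).mul_const (Real.exp (|t| / 2))
    simpa using this
  have := ge_of_tendsto' hlim fun n => key n t
  exact sub_eq_zero.1 (norm_le_zero_iff.1 this)

open BoundedContinuousFunction in
/-- Through every value of the slow variable there is a slow trajectory. -/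
lemma exists_isSlowTrajectory {M₁ : ℝ} (hfM : ∀ a, |f a| ≤ M₁) (hM : ∀ a, |g a| ≤ M)
    (hf : ∀ a b, |f a - f b| ≤ 1 / 8 * ‖a - b‖) (hg : ∀ a b, |g a - g b| ≤ 1 / 8 * ‖a - b‖)
    (ξ : ℝ) : ∃ u, IsSlowTrajectory f g u ∧ (u 0).1 = ξ ∧
      ∀ t, |(u t).2.1| ≤ M ∧ |(u t).2.2| ≤ M := by
  have hfc := continuous_of_abs_sub_le hf
  have hgc := continuous_of_abs_sub_le hg
  -- The weighted space is parametrized by bounded continuous functions, so that Banach's fixed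
  -- point theorem applies to the conjugated operator `Φ`.
  let U : (ℝ →ᵇ ℝ × ℝ × ℝ) → ℝ → ℝ × ℝ × ℝ := fun v t => Real.exp (|t| / 2) • v t
  have hU : ∀ v, Continuous (U v) := fun v => by
    have := v.continuous
    fun_prop
  have hexp : ∀ t : ℝ, Real.exp (-(|t| / 2)) * Real.exp (|t| / 2) = 1 := fun t => by
    rw [← Real.exp_add]; simp
  let Φ : (ℝ →ᵇ ℝ × ℝ × ℝ) → (ℝ →ᵇ ℝ × ℝ × ℝ) := fun v =>
    BoundedContinuousFunction.ofNormedAddCommGroup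
      (fun t => Real.exp (-(|t| / 2)) • perron f g ξ (U v) t)
      (by
        have := continuous_perron (ξ := ξ) hfc hgc hM (hU v)
        fun_prop) (|ξ| + 2 * M₁ + M) (fun t => by
        rw [norm_smul, Real.norm_eq_abs, Real.abs_exp]
        calc _ ≤ Real.exp (-(|t| / 2)) * ((|ξ| + 2 * M₁ + M) * Real.exp (|t| / 2)) := by
              gcongr
              exact norm_perron_le hfM hM t
          _ = _ := by linear_combination (|ξ| + 2 * M₁ + M) * hexp t)
  have hΦ : ContractingWith (1 / 2) Φ := by
    refine ⟨by
      rw [← NNReal.coe_lt_coe]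
      norm_num, LipschitzWith.of_dist_le_mul fun v w => ?_⟩
    rw [BoundedContinuousFunction.dist_le (by positivity)]
    intro t
    have h1 := norm_perron_sub_le (ξ := ξ) hfc hgc hM hf hg (hU v) (hU w) (d := dist v w)
      (fun s => by
        rw [← smul_sub, norm_smul, Real.norm_eq_abs, Real.abs_exp, mul_comm]
        gcongr
        rw [← dist_eq_norm]
        exact BoundedContinuousFunction.dist_coe_le_dist s) t
    have h2 := mul_le_mul_of_nonneg_left h1 (Real.exp_pos (-(|t| / 2))).le
    rw [dist_eq_norm]
    change ‖Real.exp (-(|t| / 2)) • perron f g ξ (U v) t -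
      Real.exp (-(|t| / 2)) • perron f g ξ (U w) t‖ ≤ _
    rw [← smul_sub, norm_smul, Real.norm_eq_abs, Real.abs_exp]
    refine h2.trans_eq ?_
    push_cast
    linear_combination dist v w / 2 * hexp t
  obtain ⟨v, hv, -⟩ := hΦ.exists_fixedPoint 0 (edist_ne_top _ _)
  have hfix : perron f g ξ (U v) = U v := by
    funext t
    have h1 : Real.exp (-(|t| / 2)) • perron f g ξ (U v) t = v t := DFunLike.congr_fun hv t
    change _ = Real.exp (|t| / 2) • v t
    rw [← h1, smul_smul, mul_comm, hexp, one_smul]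
  -- The fixed point inherits the bound `M` of `g` itself; this later keeps the orbit inside the
  -- truncation box.
  have hb : ∀ t, |(U v t).2.1| ≤ M ∧ |(U v t).2.2| ≤ M := fun t => by
    rw [← hfix]
    exact ⟨abs_perron_snd_le hM t, abs_perron_trd_le hM t⟩
  refine ⟨U v, ⟨fun t => ?_, fun t => ?_, fun t => ?_, M, hb⟩, ?_, hb⟩
  · have := hasDerivAt_perron_fst (g := g) (ξ := ξ) hfc (hU v) t
    rwa [hfix] at this
  · have := hasDerivAt_perron_snd (f := f) (ξ := ξ) hgc hM (hU v) t
    rwa [hfix] at this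
  · have := hasDerivAt_perron_trd (f := f) (ξ := ξ) hgc hM (hU v) t
    rwa [hfix] at this
  · rw [← hfix]
    simp [perron]

end Perron

/-! ### Algebra of the model -/

/-- The `x`-component of the field after the reflection `x ↦ σ x`, `σ = ±1`. -/
def slowRate (ν σ x y z : ℝ) : ℝ :=
  x * (ν - x ^ 2) + x ^ 3 * (y + z) + x * (y ^ 2 + z ^ 2) + σ * (y * z)

/-- The nonlinear part of the `y`- and `z`-components of the field. -/
def coupling (x y z : ℝ) : ℝ := x ^ 2 * (y + z) + x ^ 4 + y * z

lemma abs_mul_le_of_le {a b A B : ℝ} (ha : |a| ≤ A) (hb : |b| ≤ B) : |a * b| ≤ A * B := by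
  rw [abs_mul]
  exact mul_le_mul ha hb (abs_nonneg _) ((abs_nonneg _).trans ha)

/-- The pattern of the next estimates: an exact factorization into three small coefficients times
the three quantities of the target. -/
lemma abs_linear_combination_le {a b c p q r k : ℝ} (hp : |p| ≤ k) (hq : |q| ≤ k) (hr : |r| ≤ k) :
    |p * a + q * b + r * c| ≤ k * (|a| + |b| + |c|) := by
  have h1 := abs_mul_le_of_le hp (le_refl |a|)
  have h2 := abs_mul_le_of_le hq (le_refl |b|)
  have h3 := abs_mul_le_of_le hr (le_refl |c|)
  exact (abs_add_three _ _ _).trans (by linarith)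

section Estimates

variable {ν σ x y z x₁ y₁ z₁ x₂ y₂ z₂ : ℝ}

/-- The bilinear term `yz` contributes coefficients up to `1/64`; everything else is of smaller
size, which leaves room below `1/32`. -/
lemma abs_slowRate_sub_le (hν : |ν| ≤ 1 / 10000) (hσ : |σ| = 1) (hx₁ : |x₁| ≤ 1 / 64)
    (hy₁ : |y₁| ≤ 1 / 64) (hz₁ : |z₁| ≤ 1 / 64) (hx₂ : |x₂| ≤ 1 / 64) (hy₂ : |y₂| ≤ 1 / 64)
    (hz₂ : |z₂| ≤ 1 / 64) :
    |slowRate ν σ x₁ y₁ z₁ - slowRate ν σ x₂ y₂ z₂| ≤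
      1 / 32 * (|x₁ - x₂| + |y₁ - y₂| + |z₁ - z₂|) := by
  have e : slowRate ν σ x₁ y₁ z₁ - slowRate ν σ x₂ y₂ z₂ =
      (ν - (x₁ * x₁ + x₁ * x₂ + x₂ * x₂) + (x₁ * x₁ + x₁ * x₂ + x₂ * x₂) * (y₁ + z₁) +
        (y₁ * y₁ + z₁ * z₁)) * (x₁ - x₂) +
      (x₂ * x₂ * x₂ + x₂ * (y₁ + y₂) + σ * z₁) * (y₁ - y₂) +
      (x₂ * x₂ * x₂ + x₂ * (z₁ + z₂) + σ * y₂) * (z₁ - z₂) := by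
    unfold slowRate; ring
  have q1 := abs_mul_le_of_le hx₁ hx₁
  have q2 := abs_mul_le_of_le hx₁ hx₂
  have q3 := abs_mul_le_of_le hx₂ hx₂
  have q : |x₁ * x₁ + x₁ * x₂ + x₂ * x₂| ≤ 3 / 4096 := (abs_add_three _ _ _).trans (by linarith)
  have w : |y₁ + z₁| ≤ 1 / 32 := (abs_add_le _ _).trans (by linarith)
  have w1 : |y₁ + y₂| ≤ 1 / 32 := (abs_add_le _ _).trans (by linarith)
  have w2 : |z₁ + z₂| ≤ 1 / 32 := (abs_add_le _ _).trans (by linarith)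
  have qw := abs_le.1 (abs_mul_le_of_le q w)
  have yy := abs_le.1 (abs_mul_le_of_le hy₁ hy₁)
  have zz := abs_le.1 (abs_mul_le_of_le hz₁ hz₁)
  have c := abs_le.1 (abs_mul_le_of_le q3 hx₂)
  have xw1 := abs_le.1 (abs_mul_le_of_le hx₂ w1)
  have xw2 := abs_le.1 (abs_mul_le_of_le hx₂ w2)
  have s1 := abs_le.1 (abs_mul_le_of_le hσ.le hz₁)
  have s2 := abs_le.1 (abs_mul_le_of_le hσ.le hy₂)
  have q' := abs_le.1 q
  have hν' := abs_le.1 hν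
  rw [e]
  refine abs_linear_combination_le (abs_le.2 ⟨?_, ?_⟩) (abs_le.2 ⟨?_, ?_⟩) (abs_le.2 ⟨?_, ?_⟩)
  all_goals linarith

lemma abs_coupling_sub_le (hx₁ : |x₁| ≤ 1 / 64)
    (hy₁ : |y₁| ≤ 1 / 64) (hz₁ : |z₁| ≤ 1 / 64) (hx₂ : |x₂| ≤ 1 / 64) (hy₂ : |y₂| ≤ 1 / 64) :
    |coupling x₁ y₁ z₁ - coupling x₂ y₂ z₂| ≤
      1 / 32 * (|x₁ - x₂| + |y₁ - y₂| + |z₁ - z₂|) := by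
  have e : coupling x₁ y₁ z₁ - coupling x₂ y₂ z₂ =
      ((x₁ + x₂) * (y₁ + z₁) + (x₁ + x₂) * (x₁ * x₁ + x₂ * x₂)) * (x₁ - x₂) +
      (x₂ * x₂ + z₁) * (y₁ - y₂) + (x₂ * x₂ + y₂) * (z₁ - z₂) := by
    unfold coupling; ring
  have q1 := abs_mul_le_of_le hx₁ hx₁
  have q3 := abs_mul_le_of_le hx₂ hx₂
  have q : |x₁ * x₁ + x₂ * x₂| ≤ 2 / 4096 := (abs_add_le _ _).trans (by linarith)
  have w : |y₁ + z₁| ≤ 1 / 32 := (abs_add_le _ _).trans (by linarith)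
  have w1 : |x₁ + x₂| ≤ 1 / 32 := (abs_add_le _ _).trans (by linarith)
  have p1 := abs_le.1 (abs_mul_le_of_le w1 w)
  have p2 := abs_le.1 (abs_mul_le_of_le w1 q)
  have q3' := abs_le.1 q3
  have hz₁' := abs_le.1 hz₁
  have hy₂' := abs_le.1 hy₂
  rw [e]
  refine abs_linear_combination_le (abs_le.2 ⟨?_, ?_⟩) (abs_le.2 ⟨?_, ?_⟩) (abs_le.2 ⟨?_, ?_⟩)
  all_goals linarith

/-- The forcing `x⁴ = x · x³` has a small coefficient relative to `x³`, but not relative to `x⁴`;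
hence the slaving quantity is the cube. -/
lemma abs_coupling_le (hx : |x| ≤ 1 / 64) (hz : |z| ≤ 1 / 64) :
    |coupling x y z| ≤ 1 / 32 * (|x ^ 3| + |y| + |z|) := by
  have e : coupling x y z = x * x ^ 3 + (x * x + z) * y + (x * x) * z := by
    unfold coupling; ring
  have q := abs_le.1 (abs_mul_le_of_le hx hx)
  have hz' := abs_le.1 hz
  have hx' := abs_le.1 hx
  rw [e]
  refine abs_linear_combination_le (abs_le.2 ⟨?_, ?_⟩) (abs_le.2 ⟨?_, ?_⟩) (abs_le.2 ⟨?_, ?_⟩)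
  all_goals linarith

lemma abs_sq_mul_slowRate_le (hν : |ν| ≤ 1 / 10000) (hσ : |σ| = 1) (hx : |x| ≤ 1 / 64)
    (hy : |y| ≤ 1 / 64) (hz : |z| ≤ 1 / 64) :
    |3 * x ^ 2 * slowRate ν σ x y z| ≤ 1 / 32 * (|x ^ 3| + |y| + |z|) := by
  have e : 3 * x ^ 2 * slowRate ν σ x y z = (3 * (ν - x * x)) * x ^ 3 +
      (3 * (x * x * x * (x * x)) + 3 * (x * x * x * y) + 3 * (x * x * (σ * z))) * y +
      (3 * (x * x * x * (x * x)) + 3 * (x * x * x * z)) * z := by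
    unfold slowRate; ring
  have q := abs_mul_le_of_le hx hx
  have c := abs_mul_le_of_le q hx
  have c1 := abs_le.1 (abs_mul_le_of_le c q)
  have c2 := abs_le.1 (abs_mul_le_of_le c hy)
  have c3 := abs_le.1 (abs_mul_le_of_le c hz)
  have c4 := abs_le.1 (abs_mul_le_of_le q (abs_mul_le_of_le hσ.le hz))
  have q' := abs_le.1 q
  have hν' := abs_le.1 hν
  rw [e]
  refine abs_linear_combination_le (abs_le.2 ⟨?_, ?_⟩) (abs_le.2 ⟨?_, ?_⟩) (abs_le.2 ⟨?_, ?_⟩)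
  all_goals linarith

/-- For `ν ≤ 0` the slow variable decays. -/
lemma two_mul_slowRate_le (hν : ν ≤ 0) (hσ : |σ| = 1) (hx : |x| ≤ 1 / 64)
    (hy : |y| ≤ 3 / 2 * |x ^ 3|) (hz : |z| ≤ 3 / 2 * |x ^ 3|) :
    2 * x * slowRate ν σ x y z ≤ -(x ^ 2) ^ 2 := by
  set r := |x| with hr
  have hr0 : 0 ≤ r := abs_nonneg x
  have hxr : x ^ 2 = r ^ 2 := (sq_abs x).symm
  rw [abs_pow, ← hr] at hy hz
  have h1 : |x ^ 4 * (y + z)| ≤ r ^ 4 * (3 * r ^ 3) :=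
    abs_mul_le_of_le (by rw [abs_pow]) ((abs_add_le _ _).trans (by linarith))
  have h2 : |y * y| ≤ _ := abs_mul_le_of_le hy hy
  have h3 : |z * z| ≤ _ := abs_mul_le_of_le hz hz
  have h4 : |σ * (x * (y * z))| ≤ 1 * (r * (3 / 2 * r ^ 3 * (3 / 2 * r ^ 3))) :=
    abs_mul_le_of_le hσ.le (abs_mul_le_of_le hr.ge (abs_mul_le_of_le hy hz))
  have e : 2 * x * slowRate ν σ x y z = 2 * (x ^ 2 * ν) - 2 * (x ^ 2) ^ 2 + 2 * (x ^ 4 * (y + z)) +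
      2 * x ^ 2 * (y * y + z * z) + 2 * (σ * (x * (y * z))) := by
    unfold slowRate; ring
  have n1 : x ^ 2 * ν ≤ 0 := mul_nonpos_of_nonneg_of_nonpos (sq_nonneg x) hν
  have n2 : 2 * x ^ 2 * (y * y + z * z) ≤ 2 * r ^ 2 * (9 / 2 * r ^ 6) := by
    rw [hxr]
    refine mul_le_mul_of_nonneg_left ?_ (by positivity)
    linarith [(abs_le.1 h2).2, (abs_le.1 h3).2]
  have n3 := (abs_le.1 h1).2
  have n4 := (abs_le.1 h4).2
  -- All corrections are of order `r⁷` or `r⁸`, hence small multiples of `r⁴`, and half of the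
  -- leading term `-2r⁴` absorbs them.
  have m : ∀ k : ℕ, r ^ (4 + (k + 1)) ≤ r ^ 4 * (1 / 64) := fun k => by
    rw [pow_add]
    refine mul_le_mul_of_nonneg_left ?_ (by positivity)
    calc r ^ (k + 1) ≤ r ^ 1 := pow_le_pow_of_le_one hr0 (by linarith) (by omega)
      _ ≤ 1 / 64 := by simpa using hx
  have m1 := m 2
  have m2 := m 3
  norm_num at m1 m2
  rw [e]
  have : (x ^ 2) ^ 2 = r ^ 4 := by rw [hxr]; ring
  rw [this]
  have hr4 : 0 ≤ r ^ 4 := by positivity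
  nlinarith

/-- The term `yz` carries no factor `x`, unlike the rest of the slow equation. The cubic bounds
supply the missing factors, so that the error is comparable with the main term `a x (a + x)|x - a|`.
-/
lemma abs_cross_sub_le {a b c : ℝ} (ha0 : 0 < a) (hax : a ≤ x) (hx : x ≤ 1 / 64)
    (hy : |y| ≤ 3 / 2 * x ^ 3) (hb : |b| ≤ 3 / 2 * a ^ 3) (hc : |c| ≤ 3 / 2 * a ^ 3)
    (hyb : |y - b| ≤ 3 / 2 * |x - a|) (hzc : |z - c| ≤ 3 / 2 * |x - a|) :
    |a * (y * z) - x * (b * c)| ≤ 1 / 4 * (a * x * ((a + x) * |x - a|)) := by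
  have hx0 : 0 < x := by linarith
  set D := |x - a|
  have hD0 : 0 ≤ D := abs_nonneg _
  have hDa : |a - x| = D := abs_sub_comm a x
  have hprod : |y * z - b * c| ≤ 9 / 4 * (x ^ 3 + a ^ 3) * D := by
    rw [show y * z - b * c = y * (z - c) + c * (y - b) by ring]
    have t1 := abs_mul_le_of_le hy hzc
    have t2 := abs_mul_le_of_le hc hyb
    refine (abs_add_le _ _).trans ?_
    linarith
  rw [show a * (y * z) - x * (b * c) = a * (y * z - b * c) + b * c * (a - x) by ring]
  have t1 := abs_mul_le_of_le (abs_of_pos ha0).le hprod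
  have t2 := abs_mul_le_of_le (abs_mul_le_of_le hb hc) hDa.le
  refine (abs_add_le _ _).trans ((add_le_add t1 t2).trans ?_)
  have k1 : x ^ 3 + a ^ 3 ≤ x * (a + x) * (1 / 64) := by
    have h1 : x * x - a * (x - a) ≤ x * (1 / 64) := by nlinarith
    have h2 := mul_le_mul_of_nonneg_left h1 (by positivity : 0 ≤ a + x)
    linarith
  have k2 : a ^ 3 * a ^ 3 ≤ a * x * (a + x) * (1 / 64) := by
    have h0 : a ^ 3 ≤ 1 / 64 :=
      (pow_le_of_le_one ha0.le (by linarith) (by norm_num)).trans (by linarith)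
    have h1 := mul_le_mul_of_nonneg_left h0 (pow_pos ha0 3).le
    have h2 : a * a ≤ x * (a + x) := by nlinarith
    have := mul_le_mul_of_nonneg_left h2 (by positivity : 0 ≤ a * (1 / 64))
    linarith
  have k1' := mul_le_mul_of_nonneg_left k1 (by positivity : 0 ≤ a * D)
  have k2' := mul_le_mul_of_nonneg_left k2 hD0
  have pos : 0 ≤ a * x * ((a + x) * D) := by positivity
  linarith

/-- Near a nonzero equilibrium `(a, b, c)` the slow variable behaves as in the logistic
equation. -/
lemma logistic_le_slowRate {a b c : ℝ} (hσ : |σ| = 1) (hx0 : 0 < x) (hx : x ≤ 1 / 64)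
    (ha0 : 0 < a) (ha : a ≤ 1 / 64) (hy : |y| ≤ 3 / 2 * x ^ 3) (hz : |z| ≤ 3 / 2 * x ^ 3)
    (hb : |b| ≤ 3 / 2 * a ^ 3) (hc : |c| ≤ 3 / 2 * a ^ 3) (hyb : |y - b| ≤ 3 / 2 * |x - a|)
    (hzc : |z - c| ≤ 3 / 2 * |x - a|) (h0 : slowRate ν σ a b c = 0) :
    1 / 2 * x * a * (a - x) ^ 2 ≤ (a - x) * slowRate ν σ x y z := by
  set D := |x - a| with hD
  have hD0 : 0 ≤ D := abs_nonneg _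
  have hDsq : (a - x) ^ 2 = D ^ 2 := by rw [hD, sq_abs]; ring
  have hDa : |a - x| = D := abs_sub_comm a x
  have hx3 : x ^ 3 ≤ x / 4096 := by
    have : x ^ 2 ≤ 1 / 4096 := by nlinarith
    nlinarith
  have ha3 : a ^ 3 ≤ a / 4096 := by
    have : a ^ 2 ≤ 1 / 4096 := by nlinarith
    nlinarith
  have e1 : |(x ^ 2 - a ^ 2) * (y + z) + a ^ 2 * ((y - b) + (z - c)) + (y - b) * (y + b) +
      (z - c) * (z + c)| ≤ 1 / 4 * ((a + x) * D) := by
    have t1 : |(x ^ 2 - a ^ 2) * (y + z)| ≤ (D * (a + x)) * (1 / 20) := by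
      refine abs_mul_le_of_le ?_ ((abs_add_le _ _).trans (by linarith))
      rw [show x ^ 2 - a ^ 2 = (x - a) * (a + x) by ring]
      exact abs_mul_le_of_le le_rfl (abs_of_pos (by linarith)).le
    have t2 : |a ^ 2 * ((y - b) + (z - c))| ≤ ((a + x) * (1 / 64)) * (3 * D) := by
      refine abs_mul_le_of_le ?_ ((abs_add_le _ _).trans (by linarith))
      rw [abs_of_nonneg (by positivity)]
      nlinarith
    have t3 : |(y - b) * (y + b)| ≤ (3 / 2 * D) * ((a + x) / 64) :=
      abs_mul_le_of_le hyb ((abs_add_le _ _).trans (by linarith))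
    have t4 : |(z - c) * (z + c)| ≤ (3 / 2 * D) * ((a + x) / 64) :=
      abs_mul_le_of_le hzc ((abs_add_le _ _).trans (by linarith))
    have pos : 0 ≤ (a + x) * D := by positivity
    refine (abs_add_le _ _).trans ?_
    have := abs_add_three ((x ^ 2 - a ^ 2) * (y + z)) (a ^ 2 * ((y - b) + (z - c)))
      ((y - b) * (y + b))
    linarith
  have e2 : |a * (y * z) - x * (b * c)| ≤ 1 / 4 * (a * x * ((a + x) * D)) := by
    -- The estimate is symmetric in the two points, so it suffices to have it when the equilibrium
    -- is the nearer one to the origin.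
    rcases le_total a x with hax | hax
    · exact abs_cross_sub_le ha0 hax hx hy hb hc hyb hzc
    · have := abs_cross_sub_le hx0 hax ha hb hy hz (by rwa [abs_sub_comm b, abs_sub_comm a])
        (by rwa [abs_sub_comm c, abs_sub_comm a])
      rw [abs_sub_comm, hDa] at this
      refine this.trans_eq ?_
      ring
  set A := (x ^ 2 - a ^ 2) * (y + z) + a ^ 2 * ((y - b) + (z - c)) + (y - b) * (y + b) +
      (z - c) * (z + c) with hA
  set B := a * (y * z) - x * (b * c) with hB
  -- Subtracting `x` times the equilibrium equation eliminates `ν`. The main term is `a x (a - x)(a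
  -- + x)`; `A` and `B` will each take at most a quarter of it.
  have key : a * slowRate ν σ x y z = a * x * ((a - x) * (a + x)) + a * x * A + σ * B := by
    have : a * slowRate ν σ x y z - x * slowRate ν σ a b c =
        a * x * ((a - x) * (a + x)) + a * x * A + σ * B := by
      rw [hA, hB]; unfold slowRate; ring
    rw [h0] at this
    linarith
  have s1 := (abs_le.1 (abs_mul_le_of_le (abs_mul_le_of_le
    (abs_of_pos (mul_pos ha0 hx0)).le e1) hDa.le)).1
  have s2 := (abs_le.1 (abs_mul_le_of_le (abs_mul_le_of_le hσ.le e2) hDa.le)).1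
  have fin : a * (1 / 2 * x * a * (a - x) ^ 2) ≤ a * ((a - x) * slowRate ν σ x y z) := by
    have : a * ((a - x) * slowRate ν σ x y z) = a * x * (a + x) * (a - x) ^ 2 +
        a * x * A * (a - x) + σ * B * (a - x) := by
      linear_combination (a - x) * key
    rw [this, hDsq]
    have pos : 0 ≤ a * x * x * D ^ 2 := by positivity
    linarith
  exact le_of_mul_le_mul_left fin ha0

/-! ### Equilibria -/

/-- Both fast equations have the same nonlinear part, so their difference gives `y = -z`. Then `z(1
+ z) = x⁴` with `1 + z > 0` fixes the sign of `z`. -/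
lemma equilibrium_relations (hz : |z| ≤ 1 / 64)
    (h0 : slowRate ν σ x y z = 0) (h1 : y + coupling x y z = 0) (h2 : -z + coupling x y z = 0) :
    y = -z ∧ z = x ^ 4 - z ^ 2 ∧ 0 ≤ z ∧ z ≤ x ^ 4 ∧
      x * (ν - x ^ 2 + 2 * z ^ 2) = σ * z ^ 2 := by
  have hy : y = -z := by linarith
  subst hy
  have e : z = x ^ 4 - z ^ 2 := by
    unfold coupling at h2
    linear_combination -h2
  have hz' := abs_le.1 hz
  have h4 : 0 ≤ x ^ 4 := by positivity
  refine ⟨rfl, e, ?_, by nlinarith, ?_⟩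
  · nlinarith
  · unfold slowRate at h0
    linear_combination h0

/-- Solving `z + z² = x⁴` by `z = ζ x` leaves one scalar equation, `x(ν - x²)` up to terms of order
`x⁸`. It changes sign between `√ν/2` and `7√ν/5`; since `(7/5)² < 2`, the root satisfies `a² ≤ 2ν`.
-/
lemma exists_equilibrium (hν0 : 0 < ν) (hν : ν ≤ 1 / 10000) (hσ : |σ| = 1) :
    ∃ a c : ℝ, 0 < a ∧ a ^ 2 ≤ 2 * ν ∧ 0 ≤ c ∧ c ≤ a ^ 4 ∧ slowRate ν σ a (-c) c = 0 ∧
      coupling a (-c) c = c := by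
  let ζ : ℝ → ℝ := fun x => (Real.sqrt (1 + 4 * x ^ 4) - 1) / 2
  have hζ : ∀ x, ζ x + ζ x ^ 2 = x ^ 4 := fun x => by
    have : Real.sqrt (1 + 4 * x ^ 4) ^ 2 = 1 + 4 * x ^ 4 := Real.sq_sqrt (by positivity)
    simp only [ζ]
    linear_combination this / 4
  have hζ0 : ∀ x, 0 ≤ ζ x := fun x => by
    have : 1 ≤ Real.sqrt (1 + 4 * x ^ 4) := Real.one_le_sqrt.2 (by
      have : 0 ≤ x ^ 4 := by positivity
      linarith)
    simp only [ζ]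
    linarith
  have hζ1 : ∀ x, ζ x ≤ x ^ 4 := fun x => by nlinarith [hζ x, sq_nonneg (ζ x)]
  set s := Real.sqrt ν with hs
  have hs0 : 0 < s := Real.sqrt_pos.2 hν0
  have hss : s ^ 2 = ν := Real.sq_sqrt hν0.le
  have hs1 : s ≤ 1 / 100 := by nlinarith
  let φ : ℝ → ℝ := fun x => slowRate ν σ x (-ζ x) (ζ x)
  have hφ : ∀ x, φ x = x * (ν - x ^ 2) + 2 * x * ζ x ^ 2 - σ * ζ x ^ 2 := fun x => by
    simp only [φ, slowRate]; ring
  have hφc : Continuous φ := by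
    simp only [φ, slowRate, ζ]; fun_prop
  have hbd : ∀ x, |σ * ζ x ^ 2| ≤ x ^ 8 := fun x => by
    rw [abs_mul, hσ, one_mul, abs_of_nonneg (sq_nonneg _)]
    calc ζ x ^ 2 ≤ (x ^ 4) ^ 2 := pow_le_pow_left₀ (hζ0 x) (hζ1 x) 2
      _ = x ^ 8 := by ring
  have hs8 : s ^ 8 ≤ s ^ 3 * (1 / 100) ^ 5 := by
    rw [show s ^ 8 = s ^ 3 * s ^ 5 by ring]
    exact mul_le_mul_of_nonneg_left (pow_le_pow_left₀ hs0.le hs1 5) (by positivity)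
  have hs3 : 0 < s ^ 3 := by positivity
  have hlo : 0 ≤ φ (s / 2) := by
    rw [hφ, ← hss]
    have h1 := (abs_le.1 (hbd (s / 2))).2
    have h2 : 0 ≤ 2 * (s / 2) * ζ (s / 2) ^ 2 := by positivity
    nlinarith
  have hhi : φ (s * (7 / 5)) ≤ 0 := by
    rw [hφ, ← hss]
    have h1 := (abs_le.1 (hbd (s * (7 / 5)))).1
    have h2 : ζ (s * (7 / 5)) ^ 2 ≤ (s * (7 / 5)) ^ 8 := by
      calc _ ≤ ((s * (7 / 5)) ^ 4) ^ 2 := pow_le_pow_left₀ (hζ0 _) (hζ1 _) 2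
        _ = _ := by ring
    have h3 : 2 * (s * (7 / 5)) * ζ (s * (7 / 5)) ^ 2 ≤ 1 * (s * (7 / 5)) ^ 8 := by
      gcongr
      linarith
    nlinarith
  obtain ⟨a, ⟨ha1, ha2⟩, ha⟩ := intermediate_value_Icc' (by linarith : s / 2 ≤ s * (7 / 5))
    hφc.continuousOn ⟨hhi, hlo⟩
  refine ⟨a, ζ a, by linarith, by nlinarith, hζ0 a, hζ1 a, ha, ?_⟩
  unfold coupling
  linear_combination -hζ a

end Estimates

/-! ### Bounded orbits in coordinates -/

/-- A full orbit of the (reflected) model that stays in a small box. -/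
structure IsOrbit (ν σ : ℝ) (x y z : ℝ → ℝ) : Prop where
  deriv_x : ∀ t, HasDerivAt x (slowRate ν σ (x t) (y t) (z t)) t
  deriv_y : ∀ t, HasDerivAt y (y t + coupling (x t) (y t) (z t)) t
  deriv_z : ∀ t, HasDerivAt z (-z t + coupling (x t) (y t) (z t)) t
  bound_x : ∀ t, |x t| ≤ 1 / 64
  bound_y : ∀ t, |y t| ≤ 1 / 64
  bound_z : ∀ t, |z t| ≤ 1 / 64

lemma lt_of_forall_ne {x : ℝ → ℝ} (hx : Continuous x) {c : ℝ} (hne : ∀ t, x t ≠ c) {s : ℝ}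
    (hs : x s < c) (t : ℝ) : x t < c := by
  by_contra h
  obtain ⟨r, hr⟩ := mem_range_of_exists_le_of_exists_ge hx ⟨s, hs.le⟩ ⟨t, not_lt.1 h⟩
  exact hne r hr

lemma gt_of_forall_ne {x : ℝ → ℝ} (hx : Continuous x) {c : ℝ} (hne : ∀ t, x t ≠ c) {s : ℝ}
    (hs : c < x s) (t : ℝ) : c < x t := by
  by_contra h
  obtain ⟨r, hr⟩ := mem_range_of_exists_le_of_exists_ge hx ⟨t, not_lt.1 h⟩ ⟨s, hs.le⟩
  exact hne r hr

section Orbits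

variable {ν σ : ℝ} {x y z x₁ y₁ z₁ x₂ y₂ z₂ : ℝ → ℝ}

lemma IsOrbit.continuous_x (h : IsOrbit ν σ x y z) : Continuous x :=
  continuous_iff_continuousAt.2 fun t => (h.deriv_x t).continuousAt

lemma isOrbit_const {a b c : ℝ} (h0 : slowRate ν σ a b c = 0) (h1 : b + coupling a b c = 0)
    (h2 : -c + coupling a b c = 0) (ha : |a| ≤ 1 / 64) (hb : |b| ≤ 1 / 64) (hc : |c| ≤ 1 / 64) :
    IsOrbit ν σ (fun _ => a) (fun _ => b) (fun _ => c) :=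
  ⟨fun t => h0 ▸ hasDerivAt_const t a, fun t => h1 ▸ hasDerivAt_const t b,
    fun t => h2 ▸ hasDerivAt_const t c, fun _ => ha, fun _ => hb, fun _ => hc⟩

lemma IsOrbit.abs_le_cube (hν : |ν| ≤ 1 / 10000) (hσ : |σ| = 1) (h : IsOrbit ν σ x y z) (t : ℝ) :
    |y t| ≤ 3 / 2 * |x t ^ 3| ∧ |z t| ≤ 3 / 2 * |x t ^ 3| :=
  abs_le_of_expanding_contracting (m := fun t => x t ^ 3)
    (m' := fun t => 3 * x t ^ 2 * slowRate ν σ (x t) (y t) (z t))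
    (fun t => ((h.deriv_x t).pow 3).congr_deriv (by norm_num)) h.deriv_y h.deriv_z h.bound_y h.bound_z
    (fun t => abs_sq_mul_slowRate_le hν hσ (h.bound_x t) (h.bound_y t) (h.bound_z t))
    (fun t => abs_coupling_le (h.bound_x t) (h.bound_z t))
    (fun t => abs_coupling_le (h.bound_x t) (h.bound_z t)) t

/-- The difference of two orbits obeys the same weakly coupled inequalities, with `m = x₁ - x₂`. In
particular an orbit is determined by its `x`-value at one time. -/
lemma IsOrbit.abs_sub_le (hν : |ν| ≤ 1 / 10000) (hσ : |σ| = 1) (h₁ : IsOrbit ν σ x₁ y₁ z₁)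
    (h₂ : IsOrbit ν σ x₂ y₂ z₂) (t : ℝ) :
    |y₁ t - y₂ t| ≤ 3 / 2 * |x₁ t - x₂ t| ∧ |z₁ t - z₂ t| ≤ 3 / 2 * |x₁ t - x₂ t| :=
  abs_le_of_expanding_contracting (m := fun t => x₁ t - x₂ t) (y := fun t => y₁ t - y₂ t)
    (z := fun t => z₁ t - z₂ t) (B := 1 / 32)
    (g := fun t => coupling (x₁ t) (y₁ t) (z₁ t) - coupling (x₂ t) (y₂ t) (z₂ t))
    (h := fun t => coupling (x₁ t) (y₁ t) (z₁ t) - coupling (x₂ t) (y₂ t) (z₂ t))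
    (fun t => (h₁.deriv_x t).sub (h₂.deriv_x t))
    (fun t => ((h₁.deriv_y t).sub (h₂.deriv_y t)).congr_deriv (by ring))
    (fun t => ((h₁.deriv_z t).sub (h₂.deriv_z t)).congr_deriv (by ring))
    (fun t => (abs_sub _ _).trans (by linarith [h₁.bound_y t, h₂.bound_y t]))
    (fun t => (abs_sub _ _).trans (by linarith [h₁.bound_z t, h₂.bound_z t]))
    (fun t => abs_slowRate_sub_le hν hσ (h₁.bound_x t) (h₁.bound_y t) (h₁.bound_z t)
      (h₂.bound_x t) (h₂.bound_y t) (h₂.bound_z t))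
    (fun t => abs_coupling_sub_le (h₁.bound_x t) (h₁.bound_y t) (h₁.bound_z t) (h₂.bound_x t)
      (h₂.bound_y t))
    (fun t => abs_coupling_sub_le (h₁.bound_x t) (h₁.bound_y t) (h₁.bound_z t) (h₂.bound_x t)
      (h₂.bound_y t)) t

lemma IsOrbit.eq_of_x_eq (hν : |ν| ≤ 1 / 10000) (hσ : |σ| = 1) (h₁ : IsOrbit ν σ x₁ y₁ z₁)
    (h₂ : IsOrbit ν σ x₂ y₂ z₂) {t : ℝ} (h : x₁ t = x₂ t) : y₁ t = y₂ t ∧ z₁ t = z₂ t := by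
  have := h₁.abs_sub_le hν hσ h₂ t
  rw [h, sub_self, abs_zero, mul_zero] at this
  exact ⟨sub_eq_zero.1 (abs_nonpos_iff.1 this.1), sub_eq_zero.1 (abs_nonpos_iff.1 this.2)⟩

lemma IsOrbit.shift (h : IsOrbit ν σ x y z) (s : ℝ) :
    IsOrbit ν σ (fun t => x (t + s)) (fun t => y (t + s)) (fun t => z (t + s)) :=
  ⟨fun t => (h.deriv_x (t + s)).comp_add_const t s, fun t => (h.deriv_y (t + s)).comp_add_const t s,
    fun t => (h.deriv_z (t + s)).comp_add_const t s, fun _ => h.bound_x _, fun _ => h.bound_y _,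
    fun _ => h.bound_z _⟩

/-- For `ν ≤ 0` the only bounded orbit is the origin. -/
lemma IsOrbit.x_eq_zero_of_nonpos (hν : |ν| ≤ 1 / 10000) (hν0 : ν ≤ 0) (hσ : |σ| = 1)
    (h : IsOrbit ν σ x y z) (t : ℝ) : x t = 0 := by
  by_contra hne
  have hd : ∀ s, HasDerivAt (fun s => x s ^ 2)
      (2 * x s * slowRate ν σ (x s) (y s) (z s)) s := fun s =>
    ((h.deriv_x s).pow 2).congr_deriv (by norm_num)
  have hle : ∀ s, 2 * x s * slowRate ν σ (x s) (y s) (z s) ≤ -(x s ^ 2) ^ 2 := fun s =>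
    two_mul_slowRate_le hν0 hσ (h.bound_x s) (h.abs_le_cube hν hσ s).1 (h.abs_le_cube hν hσ s).2
  have hanti : Antitone fun s => x s ^ 2 :=
    antitone_of_hasDerivAt_nonpos hd fun s =>
      (hle s).trans (neg_nonpos.2 (sq_nonneg _))
  have hpos : 0 < x t ^ 2 := by positivity
  have hrev := hasDerivAt_comp_neg hd
  -- Backward from time `t`, `x²` stays at least `x t ^ 2`, so the quadratic growth `(x²)²`
  -- dominates linear growth with rate `x t ^ 2`.
  have := nonpos_of_mul_le_deriv (V := fun s => x (-s) ^ 2) (a := -t) (B := (1 / 64) ^ 2) hpos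
    (fun s _ => (hrev s).continuousAt.continuousWithinAt) (fun s _ => hrev s)
    (fun s hs => by
      have h1 := hle (-s)
      have h2 : x t ^ 2 ≤ x (-s) ^ 2 := hanti (by linarith)
      nlinarith [sq_nonneg (x (-s))])
    (fun s _ => by
      have := h.bound_x (-s)
      rw [← sq_abs]
      gcongr) le_rfl
  simp only [neg_neg] at this
  linarith

end Orbits

/-! ### Existence of a connecting orbit -/

/-- Truncation of a real number to `[lo, hi]`. -/
noncomputable def clamp (lo hi x : ℝ) : ℝ := max lo (min hi x)

lemma abs_clamp_sub_le (lo hi x y : ℝ) : |clamp lo hi x - clamp lo hi y| ≤ |x - y| := by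
  unfold clamp
  have h1 := abs_max_sub_max_le_max lo (min hi x) lo (min hi y)
  have h2 := abs_min_sub_min_le_max hi x hi y
  simp only [sub_self, abs_zero, abs_nonneg, sup_of_le_right] at h1 h2
  exact h1.trans h2

lemma clamp_of_mem {lo hi x : ℝ} (h1 : lo ≤ x) (h2 : x ≤ hi) : clamp lo hi x = x := by
  rw [clamp, min_eq_right h2, max_eq_right h1]

lemma le_clamp (lo hi x : ℝ) : lo ≤ clamp lo hi x := le_max_left _ _

lemma clamp_le {lo hi : ℝ} (h : lo ≤ hi) (x : ℝ) : clamp lo hi x ≤ hi :=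
  max_le h (min_le_left _ _)

/-- Truncation to the box `[0, a] × [-10⁻⁶, 10⁻⁶]²`. -/
noncomputable def clampBox (a : ℝ) (u : ℝ × ℝ × ℝ) : ℝ × ℝ × ℝ :=
  (clamp 0 a u.1, clamp (-1 / 10 ^ 6) (1 / 10 ^ 6) u.2.1, clamp (-1 / 10 ^ 6) (1 / 10 ^ 6) u.2.2)

section Existence

variable {ν σ a c : ℝ}

lemma clampBox_bounds (ha0 : 0 < a) (ha : a ≤ 1 / 64) (u : ℝ × ℝ × ℝ) :
    |(clampBox a u).1| ≤ a ∧ |(clampBox a u).1| ≤ 1 / 64 ∧ |(clampBox a u).2.1| ≤ 1 / 10 ^ 6 ∧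
      |(clampBox a u).2.2| ≤ 1 / 10 ^ 6 := by
  have h1 : |(clampBox a u).1| ≤ a :=
    abs_le.2 ⟨by linarith [le_clamp 0 a u.1, show (clampBox a u).1 = clamp 0 a u.1 from rfl],
      clamp_le ha0.le u.1⟩
  have h2 : ∀ y, |clamp (-1 / 10 ^ 6) (1 / 10 ^ 6) y| ≤ 1 / 10 ^ 6 := fun y =>
    abs_le.2 ⟨by linarith [le_clamp (-1 / 10 ^ 6) (1 / 10 ^ 6) y], clamp_le (by norm_num) y⟩
  exact ⟨h1, h1.trans ha, h2 _, h2 _⟩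

/-- Truncation is 1-Lipschitz, and three coordinates give `3/32 ≤ 1/8`, the constant required by the
contraction. -/
lemma sum_abs_clampBox_sub_le (u v : ℝ × ℝ × ℝ) :
    1 / 32 * (|(clampBox a u).1 - (clampBox a v).1| + |(clampBox a u).2.1 - (clampBox a v).2.1| +
      |(clampBox a u).2.2 - (clampBox a v).2.2|) ≤ 1 / 8 * ‖u - v‖ := by
  have h1 := (abs_clamp_sub_le 0 a u.1 v.1).trans (norm_fst_le (u - v))
  have h2 := (abs_clamp_sub_le (-1 / 10 ^ 6) (1 / 10 ^ 6) u.2.1 v.2.1).trans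
    ((norm_fst_le (u - v).2).trans (norm_snd_le (u - v)))
  have h3 := (abs_clamp_sub_le (-1 / 10 ^ 6) (1 / 10 ^ 6) u.2.2 v.2.2).trans
    ((norm_snd_le (u - v).2).trans (norm_snd_le (u - v)))
  simp only [clampBox]
  linarith [norm_nonneg (u - v)]

/-- Between the origin and the equilibrium `(a, -c, c)` there is a full orbit in the box. -/
lemma exists_isOrbit_between (hν : |ν| ≤ 1 / 10000) (hσ : |σ| = 1) (ha0 : 0 < a)
    (ha : a ^ 2 ≤ 2 / 10000) (hc0 : 0 ≤ c) (hca : c ≤ a ^ 4) (h0 : slowRate ν σ a (-c) c = 0)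
    (h1 : coupling a (-c) c = c) :
    ∃ x y z : ℝ → ℝ, IsOrbit ν σ x y z ∧ (∀ t, 0 < x t ∧ x t < a) ∧
      ∀ t, |y t| ≤ 1 / 10 ^ 6 ∧ |z t| ≤ 1 / 10 ^ 6 := by
  have ha64 : a ≤ 1 / 64 := by nlinarith
  have hc6 : c ≤ 1 / 10 ^ 6 := by nlinarith [sq_nonneg a]
  let f : ℝ × ℝ × ℝ → ℝ := fun u =>
    slowRate ν σ (clampBox a u).1 (clampBox a u).2.1 (clampBox a u).2.2
  let g : ℝ × ℝ × ℝ → ℝ := fun u =>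
    coupling (clampBox a u).1 (clampBox a u).2.1 (clampBox a u).2.2
  have hb := clampBox_bounds ha0 ha64
  have hb2 : ∀ u, |(clampBox a u).2.1| ≤ 1 / 64 ∧ |(clampBox a u).2.2| ≤ 1 / 64 := fun u =>
    ⟨(hb u).2.2.1.trans (by norm_num), (hb u).2.2.2.trans (by norm_num)⟩
  have hf : ∀ u v, |f u - f v| ≤ 1 / 8 * ‖u - v‖ := fun u v =>
    (abs_slowRate_sub_le hν hσ (hb u).2.1 (hb2 u).1 (hb2 u).2 (hb v).2.1 (hb2 v).1
      (hb2 v).2).trans (sum_abs_clampBox_sub_le u v)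
  have hg : ∀ u v, |g u - g v| ≤ 1 / 8 * ‖u - v‖ := fun u v =>
    (abs_coupling_sub_le (hb u).2.1 (hb2 u).1 (hb2 u).2 (hb v).2.1 (hb2 v).1).trans
      (sum_abs_clampBox_sub_le u v)
  have hfM : ∀ u, |f u| ≤ 1 := fun u => by
    have := abs_slowRate_sub_le (x₂ := 0) (y₂ := 0) (z₂ := 0) hν hσ (hb u).2.1 (hb2 u).1
      (hb2 u).2 (by norm_num) (by norm_num) (by norm_num)
    simp only [sub_zero, show slowRate ν σ 0 0 0 = 0 by simp [slowRate]] at this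
    linarith [(hb u).2.1, (hb2 u).1, (hb2 u).2]
  -- The bound of `g` on the truncation box does not exceed the box size in `y` and `z`, so the
  -- trajectory below never meets that truncation.
  have hgM : ∀ u, |g u| ≤ 1 / 10 ^ 6 := fun u => by
    obtain ⟨hx, -, hy, hz⟩ := hb u
    have hxx : |(clampBox a u).1 ^ 2| ≤ 2 / 10000 := by
      rw [abs_pow]
      exact (pow_le_pow_left₀ (abs_nonneg _) hx 2).trans ha
    have hyz : |(clampBox a u).2.1 + (clampBox a u).2.2| ≤ 2 / 10 ^ 6 :=
      (abs_add_le _ _).trans (by linarith)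
    have t1 := abs_mul_le_of_le hxx hyz
    have t2 := abs_mul_le_of_le hxx hxx
    have t3 := abs_mul_le_of_le hy hz
    simp only [g, coupling]
    rw [show (clampBox a u).1 ^ 4 = (clampBox a u).1 ^ 2 * (clampBox a u).1 ^ 2 by ring]
    refine (abs_add_three _ _ _).trans ?_
    norm_num at t1 t2 t3 ⊢
    linarith
  obtain ⟨u, hu, hu0, huM⟩ := exists_isSlowTrajectory hfM hgM hf hg (a / 2)
  -- An equilibrium is a slow trajectory. Sharing its slow coordinate at any time would mean
  -- coinciding with it for all times.
  have hfix : ∀ p : ℝ × ℝ × ℝ, f p = 0 → p.2.1 + g p = 0 → -p.2.2 + g p = 0 →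
      (u 0).1 ≠ p.1 → ∀ t, (u t).1 ≠ p.1 := fun p h0 h1 h2 hne t ht => by
    have hp : IsSlowTrajectory f g fun _ => p :=
      ⟨fun t => h0 ▸ hasDerivAt_const t p.1, fun t => h1 ▸ hasDerivAt_const t p.2.1,
        fun t => h2 ▸ hasDerivAt_const t p.2.2, max |p.2.1| |p.2.2|,
        fun t => ⟨le_max_left _ _, le_max_right _ _⟩⟩
    have hs : IsSlowTrajectory f g fun s => u (s + t) :=
      ⟨fun s => (hu.deriv_fst (s + t)).comp_add_const s t,
        fun s => (hu.deriv_snd (s + t)).comp_add_const s t,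
        fun s => (hu.deriv_trd (s + t)).comp_add_const s t, 1 / 10 ^ 6, fun s => huM _⟩
    have h3 := congrFun (hs.eq_of_fst_eq hfM hgM hf hg hp (by simpa using ht)) (-t)
    simp only [neg_add_cancel] at h3
    exact hne (by rw [h3])
  have hcl : ∀ x y z : ℝ, 0 ≤ x → x ≤ a → |y| ≤ 1 / 10 ^ 6 → |z| ≤ 1 / 10 ^ 6 →
      clampBox a (x, y, z) = (x, y, z) := fun x y z hx0 hxa hy hz => by
    have hy := abs_le.1 hy
    have hz := abs_le.1 hz
    simp only [clampBox]
    rw [clamp_of_mem hx0 hxa, clamp_of_mem (by linarith) hy.2, clamp_of_mem (by linarith) hz.2]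
  have hne0 := hfix (0, 0, 0)
    (by simp only [f]; rw [hcl 0 0 0 le_rfl ha0.le (by norm_num) (by norm_num)]; simp [slowRate])
    (by simp only [g]; rw [hcl 0 0 0 le_rfl ha0.le (by norm_num) (by norm_num)]; simp [coupling])
    (by simp only [g]; rw [hcl 0 0 0 le_rfl ha0.le (by norm_num) (by norm_num)]; simp [coupling])
    (by rw [hu0]; simp; linarith)
  have hcc : clampBox a (a, -c, c) = (a, -c, c) :=
    hcl a (-c) c ha0.le le_rfl (by rwa [abs_neg, abs_of_nonneg hc0]) (by rwa [abs_of_nonneg hc0])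
  have hnea := hfix (a, -c, c)
    (by simp only [f]; rw [hcc]; exact h0)
    (by simp only [g]; rw [hcc]; simp only; rw [h1]; ring)
    (by simp only [g]; rw [hcc]; simp only; rw [h1]; ring)
    (by rw [hu0]; simp only; linarith)
  have hcont : Continuous fun t => (u t).1 := continuous_fst.comp hu.continuous
  have hx : ∀ t, 0 < (u t).1 ∧ (u t).1 < a := fun t =>
    ⟨gt_of_forall_ne hcont hne0 (s := 0) (by rw [hu0]; simp only; linarith) t,
      lt_of_forall_ne hcont hnea (s := 0) (by rw [hu0]; simp only; linarith) t⟩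
  have hcu : ∀ t, clampBox a (u t) = u t := fun t =>
    hcl _ _ _ (hx t).1.le (hx t).2.le (huM t).1 (huM t).2
  refine ⟨fun t => (u t).1, fun t => (u t).2.1, fun t => (u t).2.2,
    ⟨fun t => ?_, fun t => ?_, fun t => ?_, fun t => ?_, fun t => (huM t).1.trans (by norm_num),
      fun t => (huM t).2.trans (by norm_num)⟩, hx, huM⟩
  · simpa only [f, hcu] using hu.deriv_fst t
  · simpa only [g, hcu] using hu.deriv_snd t
  · simpa only [g, hcu] using hu.deriv_trd t
  · rw [abs_of_pos (hx t).1]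
    linarith [hx t]

end Existence

/-! ### Logistic comparison and the limits of orbits -/

section Convergence

variable {ν σ a b c : ℝ} {x y z : ℝ → ℝ}

lemma IsOrbit.logistic (hν : |ν| ≤ 1 / 10000) (hσ : |σ| = 1) (h : IsOrbit ν σ x y z)
    (hp : IsOrbit ν σ (fun _ => a) (fun _ => b) fun _ => c) (ha : 0 < a)
    {t : ℝ} (hx : 0 < x t) :
    1 / 2 * x t * a * (a - x t) ^ 2 ≤ (a - x t) * slowRate ν σ (x t) (y t) (z t) := by
  have h1 := h.abs_le_cube hν hσ t
  have h2 := hp.abs_le_cube hν hσ t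
  have h3 := h.abs_sub_le hν hσ hp t
  rw [abs_of_pos (pow_pos hx 3)] at h1
  rw [abs_of_pos (pow_pos ha 3)] at h2
  have h0 : slowRate ν σ a b c = 0 := (hp.deriv_x t).unique (hasDerivAt_const t a)
  exact logistic_le_slowRate hσ hx ((le_abs_self _).trans (h.bound_x t)) ha
    ((le_abs_self _).trans (hp.bound_x t)) h1.1 h1.2 h2.1 h2.2 h3.1 h3.2 h0

/-- No bounded orbit starts beyond the equilibrium. -/
lemma IsOrbit.lt_equilibrium (hν : |ν| ≤ 1 / 10000) (hσ : |σ| = 1) (h : IsOrbit ν σ x y z)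
    (hp : IsOrbit ν σ (fun _ => a) (fun _ => b) fun _ => c) (ha : 0 < a)
    (hne : ∀ t, x t ≠ a) (t : ℝ) : x t < a := by
  by_contra hcon
  have hlt : ∀ s, a < x s :=
    gt_of_forall_ne h.continuous_x hne (lt_of_le_of_ne (not_lt.1 hcon) (hne t).symm)
  have hd : ∀ s, HasDerivAt (fun s => x (-s) - a)
      (-slowRate ν σ (x (-s)) (y (-s)) (z (-s))) s := fun s =>
    (hasDerivAt_comp_neg h.deriv_x s).sub_const a
  -- Backward in time the excess `x - a` grows at least at the rate `a²/2`, which a bounded orbit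
  -- cannot do.
  have := nonpos_of_forall_mul_le_deriv (c := 1 / 2 * a * a) (B := 1 / 64) (by positivity) hd
    (fun s => by
      have h1 := h.logistic hν hσ hp ha (ha.trans (hlt (-s)))
      have h2 := hlt (-s)
      have h3 : (x (-s) - a) * (1 / 2 * a * a * (x (-s) - a)) ≤
          (x (-s) - a) * -slowRate ν σ (x (-s)) (y (-s)) (z (-s)) := by
        have : 0 ≤ (x (-s) - a) * (a * (a - x (-s)) ^ 2) :=
          mul_nonneg (by linarith) (by positivity)
        nlinarith
      exact le_of_mul_le_mul_left h3 (by linarith))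
    (fun s => by linarith [(abs_le.1 (h.bound_x (-s))).2]) (-t)
  rw [neg_neg] at this
  linarith [hlt t]

lemma IsOrbit.slowRate_ge (hν : |ν| ≤ 1 / 10000) (hσ : |σ| = 1) (h : IsOrbit ν σ x y z)
    (hp : IsOrbit ν σ (fun _ => a) (fun _ => b) fun _ => c)
    (hx : ∀ t, 0 < x t ∧ x t < a) (t : ℝ) :
    1 / 2 * x t * a * (a - x t) ≤ slowRate ν σ (x t) (y t) (z t) := by
  have h1 := h.logistic hν hσ hp ((hx t).1.trans (hx t).2) (hx t).1
  refine le_of_mul_le_mul_left ?_ (sub_pos.2 (hx t).2)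
  linarith

/-- `x` increases, so in the logistic bound `a - x` is at least `a - x 0` in the past and `x` is at
least `x 0` in the future. Each time the remaining factor decays exponentially, at the rate `k`. -/
lemma IsOrbit.tendsto_x (hν : |ν| ≤ 1 / 10000) (hσ : |σ| = 1) (h : IsOrbit ν σ x y z)
    (hp : IsOrbit ν σ (fun _ => a) (fun _ => b) fun _ => c) (hx : ∀ t, 0 < x t ∧ x t < a) :
    Tendsto x atBot (𝓝 0) ∧ Tendsto x atTop (𝓝 a) := by
  have hge := h.slowRate_ge hν hσ hp hx
  have ha : 0 < a := (hx 0).1.trans (hx 0).2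
  have hmono : Monotone x := monotone_of_hasDerivAt_nonneg h.deriv_x fun t =>
    le_trans (by
      have := (hx t).1
      have := sub_pos.2 (hx t).2
      positivity) (hge t)
  have hexp : ∀ k : ℝ, 0 < k → Tendsto (fun t => Real.exp (-k * t)) atTop (𝓝 0) := fun k hk =>
    Real.tendsto_exp_atBot.comp (tendsto_id.const_mul_atTop_of_neg (by linarith))
  constructor
  · suffices Tendsto (fun t => x (-t)) atTop (𝓝 0) by
      simpa [Function.comp_def] using this.comp tendsto_neg_atBot_atTop
    have hD : 0 < a - x 0 := sub_pos.2 (hx 0).2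
    set k := 1 / 2 * a * (a - x 0)
    have hm := monotoneOn_exp_mul (V := fun t => -x (-t)) (c := -k) (a := 0)
      (h.continuous_x.comp continuous_neg).neg.continuousOn
      (fun t _ => (hasDerivAt_comp_neg h.deriv_x t).neg)
      (fun t ht => by
        have h1 := hge (-t)
        have h2 : x (-t) ≤ x 0 := hmono (by linarith)
        have h3 := (hx (-t)).1
        have h4 : x (-t) * a * (a - x 0) ≤ x (-t) * a * (a - x (-t)) := by gcongr
        simp only [k]
        linarith)
    have hlim := (hexp k (by positivity)).const_mul (x 0)
    rw [mul_zero] at hlim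
    refine squeeze_zero' (Eventually.of_forall fun t => (hx (-t)).1.le) ?_ hlim
    filter_upwards [eventually_ge_atTop 0] with t ht
    have h1 := hm (mem_Ici.2 le_rfl) (mem_Ici.2 ht) ht
    simp only [neg_neg, mul_zero, Real.exp_zero, neg_zero, one_mul, mul_neg, neg_le_neg_iff] at h1
    have h2 := mul_le_mul_of_nonneg_right h1 (Real.exp_pos (-k * t)).le
    have h3 : Real.exp (k * t) * Real.exp (-k * t) = 1 := by rw [← Real.exp_add]; simp
    calc x (-t) = Real.exp (k * t) * x (-t) * Real.exp (-k * t) := by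
          linear_combination -x (-t) * h3
      _ ≤ _ := h2
  · set k := 1 / 2 * a * x 0
    have hx0 := (hx 0).1
    have hm := monotoneOn_exp_mul (V := fun t => x t - a) (c := -k) (a := 0)
      (h.continuous_x.sub continuous_const).continuousOn
      (fun t _ => (h.deriv_x t).sub_const a)
      (fun t ht => by
        have h1 := hge t
        have h2 : x 0 ≤ x t := hmono ht.le
        have h3 := sub_pos.2 (hx t).2
        have h4 : x 0 * a * (a - x t) ≤ x t * a * (a - x t) := by gcongr
        simp only [k]
        linarith)
    have hlim := (hexp k (by positivity)).const_mul (a - x 0)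
    rw [mul_zero] at hlim
    suffices Tendsto (fun t => a - x t) atTop (𝓝 0) by
      simpa using this.const_sub a
    refine squeeze_zero' (Eventually.of_forall fun t => (sub_pos.2 (hx t).2).le) ?_ hlim
    filter_upwards [eventually_ge_atTop 0] with t ht
    have h1 := hm (mem_Ici.2 le_rfl) (mem_Ici.2 ht) ht
    simp only [neg_neg, mul_zero, Real.exp_zero, one_mul] at h1
    have h2 := mul_le_mul_of_nonneg_right h1 (Real.exp_pos (-k * t)).le
    have h3 : Real.exp (k * t) * Real.exp (-k * t) = 1 := by rw [← Real.exp_add]; simp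
    have h4 : Real.exp (k * t) * (x t - a) * Real.exp (-k * t) = x t - a := by
      linear_combination (x t - a) * h3
    linarith

end Convergence

/-! ### Linearization -/

/-- The linear map of a `3 × 3` matrix on the Euclidean space. -/
noncomputable def matrixMap (A : Matrix (Fin 3) (Fin 3) ℝ) : Space 3 →L[ℝ] Space 3 :=
  Matrix.toEuclideanCLM (n := Fin 3) (𝕜 := ℝ) A

lemma matrixMap_apply (A : Matrix (Fin 3) (Fin 3) ℝ) (v : Space 3) (i : Fin 3) :
    matrixMap A v i = A i 0 * v 0 + A i 1 * v 1 + A i 2 * v 2 := by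
  simp [matrixMap, Matrix.ofLp_toEuclideanCLM, Matrix.mulVec, dotProduct, Fin.sum_univ_three]

lemma inner_space_three (v w : Space 3) :
    inner ℝ v w = v 0 * w 0 + v 1 * w 1 + v 2 * w 2 := by
  simp only [PiLp.inner_apply, Fin.sum_univ_three, RCLike.inner_apply, conj_trivial]
  ring

lemma norm_sq_space_three (v : Space 3) : ‖v‖ ^ 2 = v 0 ^ 2 + v 1 ^ 2 + v 2 ^ 2 := by
  rw [← real_inner_self_eq_norm_sq, inner_space_three]
  ring

lemma isSymmetric_matrixMap_diagonal (d : Fin 3 → ℝ) :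
    (matrixMap (Matrix.diagonal d)).toLinearMap.IsSymmetric := fun v w => by
  simp only [ContinuousLinearMap.coe_coe, inner_space_three, matrixMap_apply]
  simp [Matrix.diagonal]
  ring

/-- The Jacobian matrix of the model. -/
def jacobian (ν : ℝ) (p : Space 3) : Matrix (Fin 3) (Fin 3) ℝ :=
  !![ν - 3 * p 0 ^ 2 + 3 * p 0 ^ 2 * (p 1 + p 2) + (p 1 ^ 2 + p 2 ^ 2),
      p 0 ^ 3 + 2 * p 0 * p 1 + p 2, p 0 ^ 3 + 2 * p 0 * p 2 + p 1;
    2 * p 0 * (p 1 + p 2) + 4 * p 0 ^ 3, 1 + p 0 ^ 2 + p 2, p 0 ^ 2 + p 1;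
    2 * p 0 * (p 1 + p 2) + 4 * p 0 ^ 3, p 0 ^ 2 + p 2, -1 + p 0 ^ 2 + p 1]

lemma hasStrictFDerivAt_modelField (ν : ℝ) (p : Space 3) :
    HasStrictFDerivAt (modelField ν) (matrixMap (jacobian ν p)) p := by
  have hc : ∀ i : Fin 3, HasStrictFDerivAt (fun u : Space 3 => u i)
      (EuclideanSpace.proj i : Space 3 →L[ℝ] ℝ) p := fun i =>
    (EuclideanSpace.proj i : Space 3 →L[ℝ] ℝ).hasStrictFDerivAt
  have hx := hc 0
  have hy := hc 1
  have hz := hc 2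
  rw [hasStrictFDerivAt_euclidean]
  intro i
  fin_cases i
  · refine ((((hx.mul ((hx.pow 2).const_sub ν)).add ((hx.pow 3).mul (hy.add hz))).add
      (hx.mul ((hy.pow 2).add (hz.pow 2)))).add (hy.mul hz)).congr_fderiv ?_
    ext v
    simp [matrixMap_apply, jacobian]
    ring
  · have h1 := ((hy.add ((hx.pow 2).mul (hy.add hz))).add (hx.pow 4)).add (hy.mul hz)
    refine h1.congr_fderiv ?_
    ext v
    simp [matrixMap_apply, jacobian]
    ring
  · have h1 := ((hz.neg.add ((hx.pow 2).mul (hy.add hz))).add (hx.pow 4)).add (hy.mul hz)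
    refine h1.congr_fderiv ?_
    ext v
    simp [matrixMap_apply, jacobian]
    ring

lemma contDiff_modelField (ν : ℝ) : ContDiff ℝ 1 (modelField ν) := by
  rw [contDiff_euclidean]
  intro i
  have hc : ∀ i : Fin 3, ContDiff ℝ 1 (fun u : Space 3 => u i) := fun i =>
    (EuclideanSpace.proj i : Space 3 →L[ℝ] ℝ).contDiff
  have h0 := hc 0
  have h1 := hc 1
  have h2 := hc 2
  fin_cases i <;> simp [modelField] <;> fun_prop

/-- The characteristic polynomial of a `3 × 3` matrix. -/
def charFun (A : Matrix (Fin 3) (Fin 3) ℝ) (r : ℝ) : ℝ :=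
  (r - A 0 0) * ((r - A 1 1) * (r - A 2 2) - A 1 2 * A 2 1) -
    A 0 1 * (A 1 0 * (r - A 2 2) + A 1 2 * A 2 0) - A 0 2 * (A 2 0 * (r - A 1 1) + A 1 0 * A 2 1)

lemma eval_charpoly_eq_charFun (A : Matrix (Fin 3) (Fin 3) ℝ) (r : ℝ) :
    A.charpoly.eval r = charFun A r := by
  rw [Matrix.eval_charpoly, Matrix.det_fin_three, charFun]
  simp
  ring

/-- Three distinct real roots exhaust a characteristic polynomial of degree 3, so all are simple and
no others exist. -/
lemma eigenvaluesAt_eq {F : Space 3 → Space 3} {p : Space 3} {A : Matrix (Fin 3) (Fin 3) ℝ}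
    (hF : HasStrictFDerivAt F (matrixMap A) p) {r₁ r₂ r₃ : ℝ} (h12 : r₁ < r₂) (h23 : r₂ < r₃)
    (h1 : charFun A r₁ = 0) (h2 : charFun A r₂ = 0) (h3 : charFun A r₃ = 0) :
    eigenvaluesAt F p = {(r₁ : ℂ), (r₂ : ℂ), (r₃ : ℂ)} := by
  have hch : (fderiv ℝ F p).toLinearMap.charpoly = A.charpoly := by
    rw [hF.hasFDerivAt.fderiv, matrixMap, Matrix.coe_toEuclideanCLM_eq_toEuclideanLin,
      Matrix.toEuclideanLin, Matrix.toLpLin_eq_toLin]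
    exact Matrix.charpoly_toLin _ _
  rw [eigenvaluesAt, hch]
  have hne : A.charpoly ≠ 0 := A.charpoly_monic.ne_zero
  have hroot : ∀ r : ℝ, charFun A r = 0 → (r : ℂ) ∈ A.charpoly.aroots ℂ := fun r hr => by
    rw [Polynomial.mem_aroots]
    refine ⟨hne, ?_⟩
    have : Polynomial.aeval (algebraMap ℝ ℂ r) A.charpoly = 0 := by
      rw [Polynomial.aeval_algebraMap_apply_eq_algebraMap_eval, eval_charpoly_eq_charFun, hr,
        map_zero]
    exact this
  have hnodup : ({(r₁ : ℂ), (r₂ : ℂ), (r₃ : ℂ)} : Multiset ℂ).Nodup := by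
    have e1 := h12.ne
    have e2 := h23.ne
    have e3 := (h12.trans h23).ne
    simp [e1, e2, e3]
  have hle : ({(r₁ : ℂ), (r₂ : ℂ), (r₃ : ℂ)} : Multiset ℂ) ≤ A.charpoly.aroots ℂ := by
    rw [Multiset.le_iff_subset hnodup]
    intro μ hμ
    simp only [Multiset.insert_eq_cons, Multiset.mem_cons, Multiset.mem_singleton] at hμ
    rcases hμ with rfl | rfl | rfl
    exacts [hroot _ h1, hroot _ h2, hroot _ h3]
  refine (Multiset.eq_of_le_of_card_le hle ?_).symm
  calc Multiset.card (A.charpoly.aroots ℂ) ≤ (A.charpoly.map (algebraMap ℝ ℂ)).natDegree :=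
        Polynomial.card_roots' _
    _ ≤ A.charpoly.natDegree := Polynomial.natDegree_map_le
    _ = 3 := by rw [Matrix.charpoly_natDegree_eq_dim]; simp
    _ ≤ _ := by simp

/-- Matrices with one weakly contracting, one expanding and one contracting direction. -/
structure IsSaddleMatrix (A : Matrix (Fin 3) (Fin 3) ℝ) (β : ℝ) : Prop where
  pos : 0 < β
  le : β ≤ 1 / 10
  h00 : A 0 0 ≤ -β
  h00' : -(1 / 10) ≤ A 0 0
  h01 : |A 0 1| ≤ β / 10
  h02 : |A 0 2| ≤ β / 10
  h10 : |A 1 0| ≤ β / 10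
  h20 : |A 2 0| ≤ β / 10
  h11 : |A 1 1 - 1| ≤ 1 / 10
  h12 : |A 1 2| ≤ 1 / 10
  h21 : |A 2 1| ≤ 1 / 10
  h22 : |A 2 2 + 1| ≤ 1 / 10

/-- The signs of the form match the diagonal of `A`. The entries coupling to the slow direction are
`O(β)` and are absorbed by Young's inequality. -/
lemma IsSaddleMatrix.coercive {A : Matrix (Fin 3) (Fin 3) ℝ} {β : ℝ} (h : IsSaddleMatrix A β)
    (v : Space 3) :
    β / 2 * ‖v‖ ^ 2 ≤ inner ℝ (matrixMap (Matrix.diagonal ![-1, 1, -1]) v) (matrixMap A v) := by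
  have e : inner ℝ (matrixMap (Matrix.diagonal ![-1, 1, -1]) v) (matrixMap A v) =
      -(A 0 0) * v 0 ^ 2 + A 1 1 * v 1 ^ 2 - A 2 2 * v 2 ^ 2 + (A 1 0 - A 0 1) * (v 0 * v 1) -
        (A 0 2 + A 2 0) * (v 0 * v 2) + (A 1 2 - A 2 1) * (v 1 * v 2) := by
    simp only [inner_space_three, matrixMap_apply]
    simp [Matrix.diagonal]
    ring
  rw [e, norm_sq_space_three]
  have hβ := h.pos
  have hβ' := h.le
  have c1 : |A 1 0 - A 0 1| ≤ β / 5 := (abs_sub _ _).trans (by linarith [h.h10, h.h01])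
  have c2 : |A 0 2 + A 2 0| ≤ β / 5 := (abs_add_le _ _).trans (by linarith [h.h02, h.h20])
  have c3 : |A 1 2 - A 2 1| ≤ 1 / 5 := (abs_sub _ _).trans (by linarith [h.h12, h.h21])
  have young : ∀ a b : ℝ, |a * b| ≤ (a ^ 2 + b ^ 2) / 2 := fun a b =>
    abs_le.2 ⟨by nlinarith [sq_nonneg (a + b)], by nlinarith [sq_nonneg (a - b)]⟩
  have d1 := (abs_le.1 (abs_mul_le_of_le c1 (young (v 0) (v 1)))).1
  have d2 := (abs_le.1 (abs_mul_le_of_le c2 (young (v 0) (v 2)))).2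
  have d3 := (abs_le.1 (abs_mul_le_of_le c3 (young (v 1) (v 2)))).1
  have f0 := mul_le_mul_of_nonneg_right (by linarith [h.h00] : β ≤ -(A 0 0)) (sq_nonneg (v 0))
  have f1 := mul_le_mul_of_nonneg_right
    (by linarith [(abs_le.1 h.h11).1] : 9 / 10 ≤ A 1 1) (sq_nonneg (v 1))
  have f2 := mul_le_mul_of_nonneg_right
    (by linarith [(abs_le.1 h.h22).2] : 9 / 10 ≤ -A 2 2) (sq_nonneg (v 2))
  have g0 : 0 ≤ β * v 0 ^ 2 := by positivity
  have g1 := mul_le_mul_of_nonneg_right hβ' (sq_nonneg (v 1))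
  have g2 := mul_le_mul_of_nonneg_right hβ' (sq_nonneg (v 2))
  linarith [sq_nonneg (v 1), sq_nonneg (v 2)]

/-- `charFun A` has the signs `-, +, -, +` at `-2, -1/2, 0, 2`. The delicate point is `0`, where the
main product is only of size `β/2`. -/
lemma IsSaddleMatrix.exists_roots {A : Matrix (Fin 3) (Fin 3) ℝ} {β : ℝ}
    (h : IsSaddleMatrix A β) :
    ∃ r₁ r₂ r₃ : ℝ, r₁ < r₂ ∧ r₂ < 0 ∧ 0 < r₃ ∧ charFun A r₁ = 0 ∧ charFun A r₂ = 0 ∧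
      charFun A r₃ = 0 := by
  have hβ := h.pos
  have hβ' := h.le
  have hcont : Continuous (charFun A) := by unfold charFun; fun_prop
  have h00 := h.h00
  have h00' := h.h00'
  have h11 := abs_le.1 h.h11
  have h22 := abs_le.1 h.h22
  have p := abs_le.1 (abs_mul_le_of_le h.h12 h.h21)
  -- These terms contain two entries coupling to the slow direction, so they are quadratic in `β`.
  have q : ∀ r : ℝ, |r| ≤ 2 →
      |A 0 1 * (A 1 0 * (r - A 2 2) + A 1 2 * A 2 0) +
        A 0 2 * (A 2 0 * (r - A 1 1) + A 1 0 * A 2 1)| ≤ β / 10 := fun r hr => by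
    have hr' := abs_le.1 hr
    have k1 : |r - A 2 2| ≤ 4 := abs_le.2 ⟨by linarith, by linarith⟩
    have k2 : |r - A 1 1| ≤ 4 := abs_le.2 ⟨by linarith, by linarith⟩
    have m1 := abs_mul_le_of_le h.h01 ((abs_add_le _ _).trans
      (add_le_add (abs_mul_le_of_le h.h10 k1) (abs_mul_le_of_le h.h12 h.h20)))
    have m2 := abs_mul_le_of_le h.h02 ((abs_add_le _ _).trans
      (add_le_add (abs_mul_le_of_le h.h20 k2) (abs_mul_le_of_le h.h10 h.h21)))
    refine (abs_add_le _ _).trans ((add_le_add m1 m2).trans ?_)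
    nlinarith
  have s1 : charFun A (-2) < 0 := by
    have e := abs_le.1 (q (-2) (by norm_num))
    have k : 1 ≤ (-2 - A 1 1) * (-2 - A 2 2) - A 1 2 * A 2 1 := by nlinarith
    have : (-2 - A 0 0) * ((-2 - A 1 1) * (-2 - A 2 2) - A 1 2 * A 2 1) ≤ -1 := by nlinarith
    unfold charFun
    linarith
  have s2 : 0 < charFun A (-(1 / 2)) := by
    have e := abs_le.1 (q (-(1 / 2)) (by norm_num [abs_le]))
    have k : (-(1 / 2) - A 1 1) * (-(1 / 2) - A 2 2) - A 1 2 * A 2 1 ≤ -(1 / 4) := by nlinarith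
    have : 1 / 20 ≤ (-(1 / 2) - A 0 0) *
        ((-(1 / 2) - A 1 1) * (-(1 / 2) - A 2 2) - A 1 2 * A 2 1) := by nlinarith
    unfold charFun
    linarith
  have s3 : charFun A 0 < 0 := by
    have e := abs_le.1 (q 0 (by norm_num))
    have k : (0 - A 1 1) * (0 - A 2 2) - A 1 2 * A 2 1 ≤ -(1 / 2) := by nlinarith
    have : (0 - A 0 0) * ((0 - A 1 1) * (0 - A 2 2) - A 1 2 * A 2 1) ≤ -(β / 2) := by nlinarith
    unfold charFun
    linarith
  have s4 : 0 < charFun A 2 := by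
    have e := abs_le.1 (q 2 (by norm_num))
    have k : 1 ≤ (2 - A 1 1) * (2 - A 2 2) - A 1 2 * A 2 1 := by nlinarith
    have : 1 ≤ (2 - A 0 0) * ((2 - A 1 1) * (2 - A 2 2) - A 1 2 * A 2 1) := by nlinarith
    unfold charFun
    linarith
  obtain ⟨r₁, hr₁, e₁⟩ := intermediate_value_Ioo (by norm_num : (-2 : ℝ) ≤ -(1 / 2))
    hcont.continuousOn ⟨s1, s2⟩
  obtain ⟨r₂, hr₂, e₂⟩ := intermediate_value_Ioo' (by norm_num : -(1 / 2 : ℝ) ≤ 0)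
    hcont.continuousOn ⟨s3, s2⟩
  obtain ⟨r₃, hr₃, e₃⟩ := intermediate_value_Ioo (by norm_num : (0 : ℝ) ≤ 2)
    hcont.continuousOn ⟨s3, s4⟩
  exact ⟨r₁, r₂, r₃, hr₁.2.trans hr₂.1, hr₂.2, hr₃.1, e₁, e₂, e₃⟩

lemma IsSaddleMatrix.isHyperbolic {F : Space 3 → Space 3} {p : Space 3}
    {A : Matrix (Fin 3) (Fin 3) ℝ} {β : ℝ} (h : IsSaddleMatrix A β) (hp : F p = 0)
    (hF : HasStrictFDerivAt F (matrixMap A) p) :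
    IsHyperbolic F p ∧ unstableDim F p = 1 ∧ stableDim F p = 2 := by
  obtain ⟨r₁, r₂, r₃, h12, h2, h3, e₁, e₂, e₃⟩ := h.exists_roots
  have heig := eigenvaluesAt_eq hF h12 (h2.trans h3) e₁ e₂ e₃
  have h1 : r₁ < 0 := h12.trans h2
  refine ⟨isHyperbolic_of_coercive hp hF ?_ (isSymmetric_matrixMap_diagonal _)
    (half_pos h.pos) h.coercive, ?_, ?_⟩
  · rw [heig]
    simp [h1.ne, h2.ne, h3.ne']
  · rw [unstableDim, heig]
    simp [Multiset.countP_eq_card_filter, Multiset.filter_singleton, h1.not_gt, h2.not_gt, h3]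
  · rw [stableDim, heig]
    simp [Multiset.countP_eq_card_filter, Multiset.filter_singleton, h1, h2, h3.not_gt]

/-- The Jacobian at the origin is diagonal, hence symmetric, and serves as its own form: `⟪Av, Av⟫ ≥
ν²‖v‖²` for either sign of `ν`. -/
lemma isHyperbolic_origin {ν : ℝ} (hν : |ν| ≤ 1 / 10000) (hν0 : ν ≠ 0) :
    IsHyperbolic (modelField ν) 0 := by
  have hJ : jacobian ν 0 = Matrix.diagonal ![ν, 1, -1] := by
    ext i j
    fin_cases i <;> fin_cases j <;> simp [jacobian]
  have hF := hasStrictFDerivAt_modelField ν 0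
  rw [hJ] at hF
  have hν' := abs_le.1 hν
  have heig := eigenvaluesAt_eq hF (r₁ := -1) (r₂ := ν) (r₃ := 1) (by linarith) (by linarith)
    (by simp [charFun]) (by simp [charFun]) (by simp [charFun])
  refine isHyperbolic_of_coercive (Q := matrixMap (Matrix.diagonal ![ν, 1, -1])) (l := ν ^ 2)
    ?_ hF ?_ (isSymmetric_matrixMap_diagonal _) (by positivity) fun v => ?_
  · ext i
    fin_cases i <;> simp [modelField]
  · rw [heig]
    simp [hν0]
  · have h1 : ν ^ 2 ≤ 1 := by nlinarith
    simp only [norm_sq_space_three, inner_space_three, matrixMap_apply]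
    simp [Matrix.diagonal]
    nlinarith [mul_nonneg (sub_nonneg.2 h1) (sq_nonneg (v 1)),
      mul_nonneg (sub_nonneg.2 h1) (sq_nonneg (v 2))]

lemma modelField_eq_zero_iff {ν : ℝ} {p : Space 3} :
    modelField ν p = 0 ↔ slowRate ν 1 (p 0) (p 1) (p 2) = 0 ∧
      p 1 + coupling (p 0) (p 1) (p 2) = 0 ∧ -p 2 + coupling (p 0) (p 1) (p 2) = 0 := by
  constructor
  · intro h
    have h0 := congrArg (fun q : Space 3 => q 0) h
    have h1 := congrArg (fun q : Space 3 => q 1) h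
    have h2 := congrArg (fun q : Space 3 => q 2) h
    simp [modelField] at h0 h1 h2
    refine ⟨?_, ?_, ?_⟩
    · unfold slowRate; linarith
    · unfold coupling; linarith
    · unfold coupling; linarith
  · rintro ⟨h0, h1, h2⟩
    unfold slowRate at h0
    unfold coupling at h1 h2
    ext i
    fin_cases i <;> simp [modelField] <;> linarith

/-- The equilibrium equation forces `ν ≈ x²`, so the slow diagonal entry `ν - 3x² + 2z²` is close to
`-2x²`; this explains `β = x²`. The off-diagonal entries are cubic in `x` or smaller. -/
lemma isSaddleMatrix_jacobian {ν : ℝ} {p : Space 3} (hx : |p 0| ≤ 1 / 64) (hz : |p 2| ≤ 1 / 64)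
    (hp : modelField ν p = 0) (hne : p ≠ 0) : IsSaddleMatrix (jacobian ν p) (p 0 ^ 2) := by
  obtain ⟨h0, h1, h2⟩ := modelField_eq_zero_iff.1 hp
  obtain ⟨hy, hzz, hz0, hz4, hbal⟩ := equilibrium_relations hz h0 h1 h2
  have hx0 : p 0 ≠ 0 := fun h => by
    refine hne ?_
    rw [h] at hz4
    have hz' : p 2 = 0 := le_antisymm (by simpa using hz4) hz0
    ext i
    fin_cases i <;> simp [h, hy, hz']
  set x := p 0 with hxdef
  set z := p 2 with hzdef
  have hβ : 0 < x ^ 2 := by positivity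
  have hβ2 : x ^ 2 ≤ 1 / 4096 := by
    rw [← sq_abs]
    nlinarith [abs_nonneg x]
  have hx3 : |x ^ 3| ≤ 1 / 64 * x ^ 2 := by
    rw [show x ^ 3 = x * x ^ 2 by ring, abs_mul, abs_of_pos hβ]
    gcongr
  have hzβ : z ≤ 1 / 4096 * x ^ 2 := by nlinarith
  have hzx : |x * z| ≤ 1 / 64 * (1 / 4096 * x ^ 2) :=
    abs_mul_le_of_le hx (by rwa [abs_of_nonneg hz0])
  have hx3' := abs_le.1 hx3
  have hzx' := abs_le.1 hzx
  have hzz2 : z ^ 2 ≤ 1 / 4096 * x ^ 2 := by nlinarith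
  -- By the slow equation this quantity has modulus `z²/|x|`, and `z ≤ x⁴`.
  have hν : |ν - x ^ 2 + 2 * z ^ 2| ≤ x ^ 2 / 2 := by
    have h3 : |x| * |ν - x ^ 2 + 2 * z ^ 2| = z ^ 2 := by
      rw [← abs_mul, hbal, one_mul, abs_of_nonneg (sq_nonneg z)]
    have h4 : z ^ 2 ≤ |x| * (x ^ 2 / 2) := by
      have h5 : z ≤ |x| * |x| ^ 3 := by
        refine hz4.trans_eq ?_
        rw [← abs_pow, ← abs_mul, show x * x ^ 3 = x ^ 4 by ring, abs_of_nonneg (by positivity)]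
      have h6 : |x| ^ 3 ≤ 1 := pow_le_one₀ (abs_nonneg x) (by linarith)
      have h7 : z ≤ |x| := by nlinarith [abs_nonneg x]
      nlinarith [abs_nonneg x]
    have hxa : 0 < |x| := abs_pos.2 hx0
    exact le_of_mul_le_mul_left (h3.le.trans h4) hxa
  have hν' := abs_le.1 hν
  have e00 : jacobian ν p 0 0 = ν - 3 * x ^ 2 + 2 * z ^ 2 := by
    simp [jacobian, hy, ← hxdef, ← hzdef]; ring
  have e01 : jacobian ν p 0 1 = x ^ 3 - 2 * (x * z) + z := by
    simp [jacobian, hy, ← hxdef, ← hzdef]; ring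
  have e02 : jacobian ν p 0 2 = x ^ 3 + 2 * (x * z) - z := by
    simp [jacobian, hy, ← hxdef, ← hzdef]; ring
  have e10 : jacobian ν p 1 0 = 4 * x ^ 3 := by
    simp [jacobian, hy, ← hxdef, ← hzdef]
  have e20 : jacobian ν p 2 0 = 4 * x ^ 3 := by
    simp [jacobian, hy, ← hxdef, ← hzdef]
  have e11 : jacobian ν p 1 1 = 1 + x ^ 2 + z := by
    simp [jacobian, ← hxdef, ← hzdef]
  have e12 : jacobian ν p 1 2 = x ^ 2 - z := by
    simp [jacobian, hy, ← hxdef, ← hzdef]; ring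
  have e21 : jacobian ν p 2 1 = x ^ 2 + z := by
    simp [jacobian, ← hxdef, ← hzdef]
  have e22 : jacobian ν p 2 2 = -1 + x ^ 2 - z := by
    simp [jacobian, hy, ← hxdef, ← hzdef]; ring
  refine ⟨hβ, by linarith, ?_, ?_, ?_, ?_, ?_, ?_, ?_, ?_, ?_, ?_⟩
  · rw [e00]; linarith
  · rw [e00]; linarith
  · rw [e01]; exact abs_le.2 ⟨by linarith, by linarith⟩
  · rw [e02]; exact abs_le.2 ⟨by linarith, by linarith⟩
  · rw [e10]; exact abs_le.2 ⟨by linarith, by linarith⟩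
  · rw [e20]; exact abs_le.2 ⟨by linarith, by linarith⟩
  · rw [e11]; exact abs_le.2 ⟨by linarith, by linarith⟩
  · rw [e12]; exact abs_le.2 ⟨by linarith, by linarith⟩
  · rw [e21]; exact abs_le.2 ⟨by linarith, by linarith⟩
  · rw [e22]; exact abs_le.2 ⟨by linarith, by linarith⟩

/-! ### The isolating cuboid -/

/-- The cuboid that isolates the bifurcation for parameters up to `1 / 10000`. -/
noncomputable abbrev isolatingBox : Set (Space 3) :=
  cuboid (-halfSides (1 / 10000)) (halfSides (1 / 10000))

lemma halfSides_zero : halfSides (1 / 10000) 0 = Real.sqrt (2 / 10000) := by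
  simp only [halfSides, Matrix.cons_val_zero]
  norm_num

lemma rpow_three_halves : (1 / 10000 : ℝ) ^ (3 / 2 : ℝ) = 1 / 10 ^ 6 := by
  rw [show (1 / 10000 : ℝ) = (1 / 100) ^ (2 : ℝ) by norm_num, ← Real.rpow_mul (by norm_num),
    show (2 : ℝ) * (3 / 2) = ((3 : ℕ) : ℝ) by norm_num, Real.rpow_natCast]
  norm_num

lemma halfSides_one : halfSides (1 / 10000) 1 = 1 / 10 ^ 6 := by
  rw [← rpow_three_halves]
  simp [halfSides]

lemma halfSides_two : halfSides (1 / 10000) 2 = 1 / 10 ^ 6 := by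
  rw [← rpow_three_halves]
  simp [halfSides]

lemma mem_isolatingBox {u : Space 3} : u ∈ isolatingBox ↔
    u 0 ^ 2 ≤ 2 / 10000 ∧ |u 1| ≤ 1 / 10 ^ 6 ∧ |u 2| ≤ 1 / 10 ^ 6 := by
  have h0 : u 0 ^ 2 ≤ 2 / 10000 ↔ |u 0| ≤ Real.sqrt (2 / 10000) :=
    ⟨Real.abs_le_sqrt, fun h => by
      rw [← sq_abs, ← Real.sq_sqrt (by norm_num : (0 : ℝ) ≤ 2 / 10000)]
      exact pow_le_pow_left₀ (abs_nonneg _) h 2⟩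
  rw [h0, abs_le, abs_le, abs_le]
  simp only [isolatingBox, cuboid, mem_ofPred_eq, Fin.forall_fin_succ, Pi.neg_apply, mem_Icc]
  simp only [Fin.isValue, Fin.succ_zero_eq_one, Fin.succ_one_eq_two, halfSides_zero,
    halfSides_one, halfSides_two, IsEmpty.forall_iff, and_true]

lemma abs_le_of_mem_isolatingBox {u : Space 3} (hu : u ∈ isolatingBox) :
    |u 0| ≤ 1 / 64 ∧ |u 1| ≤ 1 / 64 ∧ |u 2| ≤ 1 / 64 := by
  obtain ⟨h0, h1, h2⟩ := mem_isolatingBox.1 hu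
  refine ⟨abs_le_of_sq_le_sq (by linarith) (by norm_num), h1.trans (by norm_num),
    h2.trans (by norm_num)⟩

lemma modelField_zero (ν : ℝ) (u : Space 3) :
    modelField ν u 0 = slowRate ν 1 (u 0) (u 1) (u 2) := by
  simp [modelField, slowRate]

lemma modelField_one (ν : ℝ) (u : Space 3) :
    modelField ν u 1 = u 1 + coupling (u 0) (u 1) (u 2) := by
  simp [modelField, coupling]; ring

lemma modelField_two (ν : ℝ) (u : Space 3) :
    modelField ν u 2 = -u 2 + coupling (u 0) (u 1) (u 2) := by
  simp [modelField, coupling]; ring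

/-- On the `x`-faces `x² = 2/10000` and `ν ≤ 1/10000`, so the main term has speed at least `1/10⁶`.
On the other faces the linear speed is `1/10⁶` and the coupling at most `1/10⁷`. The face `x < 0` is
reflected to `σ = -1`. -/
lemma isIsolatingCuboid_modelField {ν : ℝ} (hν : ν ≤ 1 / 10000) :
    IsIsolatingCuboid (modelField ν) (-halfSides (1 / 10000)) (halfSides (1 / 10000)) {1}
      (1 / 10 ^ 7) := by
  set X := Real.sqrt (2 / 10000) with hX
  have hXX : X * X = 2 / 10000 := Real.mul_self_sqrt (by norm_num)
  have hX0 : 0 ≤ X := Real.sqrt_nonneg _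
  have hX1 : 1 / 100 ≤ X := by nlinarith
  have hX2 : X ≤ 1 / 64 := by nlinarith
  have hN : ∀ u ∈ isolatingBox, |coupling (u 0) (u 1) (u 2)| ≤ 1 / 10 ^ 7 := fun u hu => by
    obtain ⟨hx, hy, hz⟩ := mem_isolatingBox.1 hu
    have hxx : |u 0 ^ 2| ≤ 2 / 10000 := by rwa [abs_of_nonneg (sq_nonneg _)]
    have hyz : |u 1 + u 2| ≤ 2 / 10 ^ 6 := (abs_add_le _ _).trans (by linarith)
    have t1 := abs_mul_le_of_le hxx hyz
    have t2 := abs_mul_le_of_le hxx hxx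
    have t3 := abs_mul_le_of_le hy hz
    unfold coupling
    rw [show u 0 ^ 4 = u 0 ^ 2 * u 0 ^ 2 by ring]
    refine (abs_add_three _ _ _).trans ?_
    norm_num at t1 t2 t3 ⊢
    linarith
  have hface : ∀ u ∈ isolatingBox, ∀ σ : ℝ, |σ| = 1 →
      slowRate ν σ X (u 1) (u 2) ≤ -(1 / 10 ^ 7) := fun u hu σ hσ => by
    obtain ⟨-, hy, hz⟩ := mem_isolatingBox.1 hu
    have hyz : |u 1 + u 2| ≤ 2 / 10 ^ 6 := (abs_add_le _ _).trans (by linarith)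
    have t1 := (abs_le.1 (abs_mul_le_of_le (abs_of_nonneg hX0).le hyz)).2
    have t2 := (abs_le.1 (abs_mul_le_of_le hy hy)).2
    have t3 := (abs_le.1 (abs_mul_le_of_le hz hz)).2
    have t4 := (abs_le.1 (abs_mul_le_of_le hσ.le (abs_mul_le_of_le hy hz))).2
    have t5 : X * (u 1 * u 1 + u 2 * u 2) ≤ X * (2 / 10 ^ 12) := by
      refine mul_le_mul_of_nonneg_left ?_ hX0
      norm_num at t2 t3 ⊢
      linarith
    have t6 : X * (ν - 2 / 10000) ≤ X * (-1 / 10000) :=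
      mul_le_mul_of_nonneg_left (by linarith) hX0
    have e : slowRate ν σ X (u 1) (u 2) = X * (ν - 2 / 10000) + 2 / 10000 * (X * (u 1 + u 2)) +
        X * (u 1 * u 1 + u 2 * u 2) + σ * (u 1 * u 2) := by
      unfold slowRate
      linear_combination (-X + X * (u 1 + u 2)) * hXX
    rw [e]
    norm_num at t1 t4 t5 ⊢
    linarith
  have hrefl : ∀ u : Space 3, slowRate ν 1 (-X) (u 1) (u 2) = -slowRate ν (-1) X (u 1) (u 2) :=
    fun u => by unfold slowRate; ring
  refine ⟨by norm_num, ?_, ?_, ?_, ?_, ?_⟩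
  · intro i
    fin_cases i
    · simp only [Fin.zero_eta, Pi.neg_apply, halfSides_zero, ← hX]; linarith
    · simp only [Fin.mk_one, Pi.neg_apply, halfSides_one]; norm_num
    · simp only [Fin.reduceFinMk, Pi.neg_apply, halfSides_two]; norm_num
  · intro u hu i hi h
    rw [Finset.mem_singleton] at hi
    subst hi
    have := abs_le.1 (hN u hu)
    rw [halfSides_one] at h
    rw [modelField_one]
    linarith
  · intro u hu i hi h
    rw [Finset.mem_singleton] at hi
    subst hi
    have := abs_le.1 (hN u hu)
    rw [Pi.neg_apply, halfSides_one] at h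
    rw [modelField_one]
    linarith
  · intro u hu i hi h
    have := abs_le.1 (hN u hu)
    fin_cases i
    · simp only [Fin.zero_eta, halfSides_zero, ← hX] at h ⊢
      rw [modelField_zero, h]
      exact hface u hu 1 abs_one
    · simp at hi
    · simp only [Fin.reduceFinMk, halfSides_two] at h ⊢
      rw [modelField_two]
      linarith
  · intro u hu i hi h
    have := abs_le.1 (hN u hu)
    fin_cases i
    · simp only [Fin.zero_eta, Pi.neg_apply, halfSides_zero, ← hX] at h ⊢
      rw [modelField_zero, h, hrefl]
      linarith [hface u hu (-1) (by simp)]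
    · simp at hi
    · simp only [Fin.reduceFinMk, Pi.neg_apply, halfSides_two] at h ⊢
      rw [modelField_two]
      linarith

/-! ### From coordinates to the phase space -/

/-- The point with coordinates `(σ x, y, z)`. -/
noncomputable def point (σ x y z : ℝ) : Space 3 := !₂[σ * x, y, z]

lemma continuous_point (σ : ℝ) : Continuous fun q : ℝ × ℝ × ℝ => point σ q.1 q.2.1 q.2.2 := by
  refine (PiLp.continuous_toLp 2 _).comp (continuous_pi fun i => ?_)
  fin_cases i <;> simp <;> fun_prop

lemma point_eq {σ : ℝ} (hσ : σ * σ = 1) (u : Space 3) : point σ (σ * u 0) (u 1) (u 2) = u := by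
  ext i
  fin_cases i <;> simp [point, ← mul_assoc, hσ]

lemma slowRate_reflect {σ : ℝ} (hσ : σ * σ = 1) (ν x y z : ℝ) :
    slowRate ν 1 (σ * x) y z = σ * slowRate ν σ x y z := by
  unfold slowRate
  linear_combination (-σ * x ^ 3 + σ * x ^ 3 * (y + z) - y * z) * hσ

lemma coupling_reflect {σ : ℝ} (hσ : σ * σ = 1) (x y z : ℝ) :
    coupling (σ * x) y z = coupling x y z := by
  unfold coupling
  linear_combination (x ^ 2 * (y + z) + x ^ 4 * (σ * σ + 1)) * hσ

lemma IsOrbit.isFullSolution {ν σ : ℝ} (hσ : σ * σ = 1) {x y z : ℝ → ℝ}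
    (h : IsOrbit ν σ x y z) :
    IsFullSolution (modelField ν) fun t => point σ (x t) (y t) (z t) := fun t => by
  have h1 : HasDerivAt (fun s => ![σ * x s, y s, z s])
      ![σ * slowRate ν σ (x t) (y t) (z t), y t + coupling (x t) (y t) (z t),
        -z t + coupling (x t) (y t) (z t)] t := by
    rw [hasDerivAt_pi]
    intro i
    fin_cases i
    · exact (h.deriv_x t).const_mul σ
    · exact h.deriv_y t
    · exact h.deriv_z t
  refine ((PiLp.hasFDerivAt_toLp 2 _).comp_hasDerivAt t h1).congr_deriv ?_
  ext i
  fin_cases i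
  · exact ((modelField_zero ν _).trans (slowRate_reflect hσ ν _ _ _)).symm
  · exact ((modelField_one ν _).trans
      (congrArg (y t + ·) (coupling_reflect hσ (x t) (y t) (z t)))).symm
  · exact ((modelField_two ν _).trans
      (congrArg (-z t + ·) (coupling_reflect hσ (x t) (y t) (z t)))).symm

lemma IsFullSolution.isOrbit {ν σ : ℝ} (hσ : σ * σ = 1) {u : ℝ → Space 3}
    (h : IsFullSolution (modelField ν) u) (hu : ∀ t, u t ∈ isolatingBox) :
    IsOrbit ν σ (fun t => σ * u t 0) (fun t => u t 1) (fun t => u t 2) := by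
  have hd : ∀ (i : Fin 3) t, HasDerivAt (fun s => u s i) (modelField ν (u t) i) t := fun i t =>
    (EuclideanSpace.proj i : Space 3 →L[ℝ] ℝ).hasFDerivAt.comp_hasDerivAt t (h t)
  have hσ1 : |σ| = 1 := by
    have : |σ| * |σ| = 1 := by rw [← abs_mul, hσ, abs_one]
    nlinarith [abs_nonneg σ]
  have hb := fun t => abs_le_of_mem_isolatingBox (hu t)
  refine ⟨fun t => ((hd 0 t).const_mul σ).congr_deriv ?_, fun t => (hd 1 t).congr_deriv ?_,
    fun t => (hd 2 t).congr_deriv ?_, fun t => ?_, fun t => (hb t).2.1, fun t => (hb t).2.2⟩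
  · have := slowRate_reflect hσ ν (σ * u t 0) (u t 1) (u t 2)
    rw [← mul_assoc, hσ, one_mul] at this
    rw [modelField_zero, this, ← mul_assoc, hσ, one_mul]
  · rw [modelField_one, coupling_reflect hσ]
  · rw [modelField_two, coupling_reflect hσ]
  · rw [abs_mul, hσ1, one_mul]
    exact (hb t).1

lemma eq_zero_of_fst_eq_zero {ν : ℝ} (hν : |ν| ≤ 1 / 10000) {u : ℝ → Space 3}
    (h : IsFullSolution (modelField ν) u) (hu : ∀ t, u t ∈ isolatingBox) {t : ℝ}
    (h0 : u t 0 = 0) : u t = 0 := by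
  have := (h.isOrbit (σ := 1) (by norm_num) hu).abs_le_cube hν abs_one t
  simp only [h0, mul_zero, ne_eq, OfNat.ofNat_ne_zero, not_false_eq_true, zero_pow, abs_zero,
    abs_nonpos_iff] at this
  ext i
  fin_cases i
  exacts [h0, this.1, this.2]

/-- Each half of the phase space contains one equilibrium, connected to the origin by a
heteroclinic orbit, and no other bounded orbits. -/
lemma exists_branch {ν σ : ℝ} (hν0 : 0 < ν) (hν : ν ≤ 1 / 10000) (hσ : σ * σ = 1) :
    ∃ q ∈ isolatingBox, ∃ γ : ℝ → Space 3, 0 < σ * q 0 ∧ modelField ν q = 0 ∧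
      IsHeteroclinic (modelField ν) 0 q γ ∧ (∀ t, γ t ∈ isolatingBox) ∧
      ∀ u, IsFullSolution (modelField ν) u → (∀ t, u t ∈ isolatingBox) → 0 < σ * u 0 0 →
        u 0 = q ∨ u 0 ∈ range γ := by
  have hνa : |ν| ≤ 1 / 10000 := by rwa [abs_of_pos hν0]
  have hσ1 : |σ| = 1 := by
    have : |σ| * |σ| = 1 := by rw [← abs_mul, hσ, abs_one]
    nlinarith [abs_nonneg σ]
  obtain ⟨a, c, ha0, ha2, hc0, hca, hr, hN⟩ := exists_equilibrium hν0 hν hσ1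
  have ha2' : a ^ 2 ≤ 2 / 10000 := by linarith
  have hc6 : c ≤ 1 / 10 ^ 6 := by nlinarith [sq_nonneg a]
  have hc6' : |c| ≤ 1 / 10 ^ 6 := by rwa [abs_of_nonneg hc0]
  have hp : IsOrbit ν σ (fun _ => a) (fun _ => -c) fun _ => c :=
    isOrbit_const hr (by rw [hN]; ring) (by rw [hN]; ring)
      (abs_le_of_sq_le_sq (by linarith) (by norm_num))
      (by rw [abs_neg]; exact hc6'.trans (by norm_num)) (hc6'.trans (by norm_num))
  obtain ⟨x, y, z, ho, hx, hyz⟩ := exists_isOrbit_between hνa hσ1 ha0 ha2' hc0 hca hr hN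
  have hmem : ∀ x y z : ℝ, x ^ 2 ≤ 2 / 10000 → |y| ≤ 1 / 10 ^ 6 → |z| ≤ 1 / 10 ^ 6 →
      point σ x y z ∈ isolatingBox := fun x y z h1 h2 h3 => by
    rw [mem_isolatingBox]
    simp only [point, Fin.isValue, PiLp.toLp_apply, Matrix.cons_val_zero, Matrix.cons_val_one,
      Matrix.cons_val]
    rw [mul_pow, sq σ, hσ, one_mul]
    exact ⟨h1, h2, h3⟩
  have hpfull := hp.isFullSolution hσ
  have hfull := ho.isFullSolution hσ
  have hq0 : σ * point σ a (-c) c 0 = a := by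
    simp [point, ← mul_assoc, hσ]
  obtain ⟨hbot, htop⟩ := ho.tendsto_x hνa hσ1 hp hx
  have hlim : ∀ {l : Filter ℝ} {A B C : ℝ}, Tendsto x l (𝓝 A) → Tendsto y l (𝓝 B) →
      Tendsto z l (𝓝 C) →
      Tendsto (fun t => point σ (x t) (y t) (z t)) l (𝓝 (point σ A B C)) := fun h1 h2 h3 =>
    ((continuous_point σ).tendsto (_, _, _)).comp (h1.prodMk_nhds (h2.prodMk_nhds h3))
  refine ⟨point σ a (-c) c, hmem _ _ _ ha2' (by rwa [abs_neg]) hc6',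
    fun t => point σ (x t) (y t) (z t), by rwa [hq0],
    (hpfull 0).unique (hasDerivAt_const 0 _), ⟨?_, hfull, ?_, ?_⟩, fun t => ?_, ?_⟩
  · intro h
    rw [← h] at hq0
    simp at hq0
    exact ha0.ne hq0
  · have h0 : point σ 0 0 0 = 0 := by
      ext i
      fin_cases i <;> simp [point]
    have hcube : Tendsto (fun t => 3 / 2 * |x t ^ 3|) atBot (𝓝 0) := by
      simpa using ((hbot.pow 3).abs).const_mul (3 / 2)
    rw [← h0]
    exact hlim hbot (squeeze_zero_norm (fun t => (ho.abs_le_cube hνa hσ1 t).1) hcube)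
      (squeeze_zero_norm (fun t => (ho.abs_le_cube hνa hσ1 t).2) hcube)
  · have hdiff : Tendsto (fun t => 3 / 2 * |x t - a|) atTop (𝓝 0) := by
      simpa using ((htop.sub_const a).abs).const_mul (3 / 2)
    exact hlim htop
      (tendsto_sub_nhds_zero_iff.1
        (squeeze_zero_norm (fun t => (ho.abs_sub_le hνa hσ1 hp t).1) hdiff))
      (tendsto_sub_nhds_zero_iff.1
        (squeeze_zero_norm (fun t => (ho.abs_sub_le hνa hσ1 hp t).2) hdiff))
  · refine hmem _ _ _ ?_ (hyz t).1 (hyz t).2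
    exact (pow_le_pow_left₀ (hx t).1.le (hx t).2.le 2).trans ha2'
  · intro u hu huR hpos
    have hou := hu.isOrbit hσ huR
    -- An orbit over `a` at some time is the equilibrium by the graph property. Otherwise it stays
    -- below `a`, the connecting orbit passes over the same `x`-value at some time `s`, and the
    -- graph property makes the two points equal.
    by_cases hex : ∃ t, σ * u t 0 = a
    · obtain ⟨t, ht⟩ := hex
      left
      obtain ⟨e1, e2⟩ := hou.eq_of_x_eq hνa hσ1 hp ht
      have e : u t = point σ a (-c) c := by rw [← point_eq hσ (u t), ht, e1, e2]
      exact congrFun (hu.eq_of_eq (contDiff_modelField ν) hpfull e) 0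
    · right
      push Not at hex
      have hlt := hou.lt_equilibrium hνa hσ1 hp ha0 hex 0
      obtain ⟨s, hs⟩ := mem_range_of_exists_le_of_exists_ge ho.continuous_x
        (hbot.eventually_le_const hpos).exists (htop.eventually_const_le hlt).exists
      obtain ⟨e1, e2⟩ := (ho.shift s).eq_of_x_eq hνa hσ1 hou (t := 0) (by simpa using hs)
      refine ⟨s, ?_⟩
      simp only [zero_add] at e1 e2
      simp only
      rw [hs, e1, e2, point_eq hσ]

lemma isPitchforkBifurcation_modelField :
    IsPitchforkBifurcation modelField (-(1 / 10000)) (1 / 10000) (-halfSides (1 / 10000))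
      (halfSides (1 / 10000)) {1} 0 := by
  have hzero : (0 : Space 3) ∈ isolatingBox := by
    rw [mem_isolatingBox]
    norm_num
  have hfix : ∀ ν, modelField ν 0 = 0 := fun ν => by
    rw [modelField_eq_zero_iff]
    simp [slowRate, coupling]
  have habs : ∀ q ∈ isolatingBox, |q 0| ≤ 1 / 64 ∧ |q 2| ≤ 1 / 64 := fun q hq =>
    ⟨(abs_le_of_mem_isolatingBox hq).1, (abs_le_of_mem_isolatingBox hq).2.2⟩
  refine ⟨by norm_num, by norm_num, ⟨_, fun ν hν => isIsolatingCuboid_modelField hν.2⟩, hzero,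
    fun ν _ => hfix ν, fun ν hν h0 => isHyperbolic_origin (abs_le.2 hν) h0, fun ν hν => ?_,
    fun ν hν => ?_⟩
  · have hνa : |ν| ≤ 1 / 10000 := abs_le.2 ⟨hν.1, hν.2.trans (by norm_num)⟩
    refine isMaximalInvariant_of_forall (contDiff_modelField ν) (singleton_subset_iff.2 hzero)
      (fun p hp => ⟨fun _ => 0, isFullSolution_const (hfix ν), ⟨0, hp.symm⟩, fun _ => rfl⟩)
      fun u hu huR => ?_
    refine eq_zero_of_fst_eq_zero hνa hu huR ?_
    have := (hu.isOrbit (σ := 1) (by norm_num) huR).x_eq_zero_of_nonpos hνa hν.2 abs_one 0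
    simpa using this
  · have hνa : |ν| ≤ 1 / 10000 := by rw [abs_of_pos hν.1]; exact hν.2
    obtain ⟨up, hup, γp, hup0, hupf, hγp, hγpR, hcp⟩ :=
      exists_branch (σ := 1) hν.1 hν.2 (by norm_num)
    obtain ⟨um, hum, γm, hum0, humf, hγm, hγmR, hcm⟩ :=
      exists_branch (σ := -1) hν.1 hν.2 (by norm_num)
    have hhyp : ∀ q ∈ isolatingBox, modelField ν q = 0 → q ≠ 0 → IsHyperbolic (modelField ν) q :=
      fun q hq hqf hne => ((isSaddleMatrix_jacobian (habs q hq).1 (habs q hq).2 hqf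
        hne).isHyperbolic hqf (hasStrictFDerivAt_modelField ν q)).1
    refine ⟨um, hum, up, hup, hγm.ne.symm, hγp.ne.symm, fun h => ?_,
      hhyp um hum humf hγm.ne.symm, hhyp up hup hupf hγp.ne.symm, γm, γp, hγm, hγp, ?_⟩
    · rw [h] at hum0
      linarith
    · refine isMaximalInvariant_of_forall (contDiff_modelField ν) ?_ ?_ ?_
      · rintro p ((hp | ⟨t, rfl⟩) | ⟨t, rfl⟩)
        · rcases hp with rfl | rfl | rfl
          exacts [hzero, hum, hup]
        · exact hγmR t
        · exact hγpR t
      · rintro p ((hp | ⟨t, rfl⟩) | ⟨t, rfl⟩)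
        · refine ⟨fun _ => p, isFullSolution_const ?_, ⟨0, rfl⟩, fun _ => Or.inl (Or.inl hp)⟩
          rcases hp with rfl | rfl | rfl
          exacts [hfix ν, humf, hupf]
        · exact ⟨γm, hγm.full, ⟨t, rfl⟩, fun s => Or.inl (Or.inr ⟨s, rfl⟩)⟩
        · exact ⟨γp, hγp.full, ⟨t, rfl⟩, fun s => Or.inr ⟨s, rfl⟩⟩
      · intro u hu huR
        -- The sign of the slow coordinate selects the branch; on `x = 0` the cubic bound leaves
        -- only the origin.
        rcases lt_trichotomy (u 0 0) 0 with h | h | h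
        · rcases hcm u hu huR (by linarith) with h | h
          · exact Or.inl (Or.inl (Or.inr (Or.inl h)))
          · exact Or.inl (Or.inr h)
        · exact Or.inl (Or.inl (Or.inl (eq_zero_of_fst_eq_zero hνa hu huR h)))
        · rcases hcp u hu huR (by linarith) with h | h
          · exact Or.inl (Or.inl (Or.inr (Or.inr h)))
          · exact Or.inr h

end PitchforkModel

theorem mainTheorem2 :
    ∃ νm νp : ℝ, νm < 0 ∧ 0 < νp ∧
      PitchforkModel.IsPitchforkBifurcation PitchforkModel.modelField νm νp
        (-PitchforkModel.halfSides νp) (PitchforkModel.halfSides νp) {1} 0 ∧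
      ∀ ν ∈ Set.Ioc 0 νp,
        ∀ p ∈ PitchforkModel.cuboid (-PitchforkModel.halfSides νp) (PitchforkModel.halfSides νp),
          PitchforkModel.modelField ν p = 0 → p ≠ 0 →
            PitchforkModel.IsHyperbolic (PitchforkModel.modelField ν) p ∧
              PitchforkModel.unstableDim (PitchforkModel.modelField ν) p = 1 ∧
              PitchforkModel.stableDim (PitchforkModel.modelField ν) p = 2 := by
  -- With this `ν₊`, `√(2ν₊) < 1/64`, so the cuboid lies where all estimates hold, and `ν₊^(3/2) =
  -- 1/10⁶` is rational.
  refine ⟨-(1 / 10000), 1 / 10000, by norm_num, by norm_num,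
    PitchforkModel.isPitchforkBifurcation_modelField, fun ν _ p hp hp0 hne => ?_⟩
  have hb := PitchforkModel.abs_le_of_mem_isolatingBox hp
  exact (PitchforkModel.isSaddleMatrix_jacobian hb.1 hb.2.2 hp0 hne).isHyperbolic hp0
    (PitchforkModel.hasStrictFDerivAt_modelField ν p)
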